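/- A \emph{Real groupoid} is a topological groupoid $\mathcal G\rightrightarrows X$ (source $s$, range $r$) with an involutive continuous strict automorphism $\rho$ of $\mathcal G$ (also written $\bar g=\rho(g)$, and acting on $X$). Let $(\mathcal G,\rho)$ be a Real groupoid with $\mathcal G$ locally compact Hausdorff. \textbf{Line bundles.} A \emph{Real line $\mathcal G$-bundle} is a complex vector bundle $\pi:\mathcal L\to X$ of rank one with a continuous involution $\nu$ of $\mathcal L$ that covers $\rho$ and is $\mathbb C$-antilinear on the fibres, and a continuous action of $\mathcal G$ by $\mathbb C$-linear maps $g:\mathcal L_{s(g)}\to\mathcal L_{r(g)}$ with $\nu(g\cdot v)=\rho(g)\cdot\nu(v)$. Homomorphisms are the $\mathcal G$-equivariant homomorphisms of complex vector bundles that intertwine the involutions. $(\mathcal L,\nu)$ is \emph{locally trivial} if there are an open cover $(U_j)_{j\in J}$ of $X$ with an involution $j\mapsto\bar j$ of $J$ such that $U_{\bar j}=\rho(U_j)$, and isomorphisms of complex vector bundles $\varphi_j:U_j\times\mathbb C\to\mathcal L_{|U_j}$ with $\varphi_{\bar j}(\rho(x),\bar z)=\nu(\varphi_j(x,z))$. A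 locally trivial $(\mathcal L,\nu)$ is \emph{hermitian} if it carries a continuous $h:\mathcal L\to\mathbb R_+$ with $h(\nu(v))=h(v)$, $h(vz)=h(v)|z|^2$, $h(g\cdot v)=h(v)$, and $h(v)>0$ for $v\neq0$. $\mathrm{PicR}(\mathcal G)$ is the set of isomorphism classes (as Real line $\mathcal G$-bundles) of locally trivial hermitian Real line $\mathcal G$-bundles. \textbf{Cohomology.} Let $\mathcal G_n$ be the space of strict morphisms from the pair groupoid $[n]\times[n]\rightrightarrows[n]$, $[n]=\{0,\dots,n\}$, to $\mathcal G$, with involution $\rho_n$ and maps $\tilde f:\mathcal G_n\to\mathcal G_m$ for nondecreasing $f:[m]\to[n]$. A \emph{Real open cover} $\mathcal U$ of $\mathcal G_\bullet$ consists, for every $n$, of an open cover $(U^n_j)_{j\in J_n}$ of $\mathcal G_n$ and an involution $j\mapsto\bar j$ of $J_n$ with $U^n_{\bar j}=\rho_n(U^n_j)$. A refinement $\theta$ of $\mathcal U$ by $\mathcal V=(V^n_i)_{i\in I_n}$ is a family of maps $\theta_n:I_n\to J_n$ commuting with the involutions such that $V^n_i\subseteq U^n_{\theta_n(i)}$. Let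 $\Lambda_n$ be the set of families $\lambda=(\lambda_\varphi)$ with $\lambda_\varphi\in J_k$ for each increasing $\varphi:[k]\to[n]$, let $\bar\lambda_\varphi=\overline{\lambda_\varphi}$, $(\tilde f\lambda)_\varphi=\lambda_{f\circ\varphi}$ for increasing $f$, and $U_\lambda=\bigcap_\varphi\tilde\varphi^{-1}(U^k_{\lambda_\varphi})\subseteq\mathcal G_n$. Let $CR^n(\mathcal U)$ be the group of families of continuous $c_\lambda:U_\lambda\to\mathbb S^1$ $(\lambda\in\Lambda_n)$ with $c_{\bar\lambda}(\rho_n(x))=\overline{c_\lambda(x)}$, and let $(dc)_\lambda=\prod_{k=0}^{n+1}\big(c_{\tilde\varepsilon_k\lambda}\circ\tilde\varepsilon_k\big)^{(-1)^k}$, where $\varepsilon_k:[n]\to[n+1]$ is the increasing map that avoids $k$. Let $HR^n(\mathcal U)=\ker d^n/\operatorname{im}d^{n-1}$, and let $\check HR^n(\mathcal G_\bullet,\mathbb S^1)=\varinjlim HR^n(\mathcal U)$, the inductive limit in abelian groups along refinements over those Real open covers for which, for some $N\ge n+1$, the sets $J_0,\dots,J_N$ carry an $N$-truncated simplicial structure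 compatible with the involutions such that $\tilde f(U^n_j)\subseteq U^m_{\tilde f(j)}$ for all nondecreasing $f:[m]\to[n]$, $m,n\le N$. \textbf{Theorem.} $\mathrm{PicR}(\mathcal G)$ is an abelian group under the tensor product: there is an abelian group structure on $\mathrm{PicR}(\mathcal G)$ for which $[\mathcal L]\cdot[\mathcal L']=[\mathcal M]$ if and only if $\mathcal M\cong\mathcal L\otimes\mathcal L'$ as Real line $\mathcal G$-bundles. Furthermore, there is an isomorphism of groups $$\mathrm{PicR}(\mathcal G)\cong\check HR^1(\mathcal G_\bullet,\mathbb S^1),$$ where $\mathbb S^1$ carries complex conjugation. -/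

import Mathlib

open Bundle DirectSum

universe u

noncomputable section

/-! ### Real groupoids -/

/-- A topological groupoid `Arr ⇉ Obj` with continuous structure maps, together with a Real
structure `ρ`: an involutive (hence homeomorphic) continuous strict endomorphism.
`mul g h` is defined when `s g = r h`. -/
structure RealGroupoid : Type (u + 1) where
  Obj : Type u
  Arr : Type u
  [topObj : TopologicalSpace Obj]
  [topArr : TopologicalSpace Arr]
  s : Arr → Obj
  r : Arr → Obj
  one : Obj → Arr
  inv : Arr → Arr
  mul : ∀ g h : Arr, s g = r h → Arr
  s_one : ∀ x, s (one x) = x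
  r_one : ∀ x, r (one x) = x
  s_mul : ∀ g h e, s (mul g h e) = s h
  r_mul : ∀ g h e, r (mul g h e) = r g
  s_inv : ∀ g, s (inv g) = r g
  r_inv : ∀ g, r (inv g) = s g
  one_mul : ∀ g, mul (one (r g)) g (s_one _) = g
  mul_one : ∀ g, mul g (one (s g)) (r_one _).symm = g
  mul_assoc : ∀ g h k (e₁ : s g = r h) (e₂ : s h = r k),
    mul (mul g h e₁) k ((s_mul g h e₁).trans e₂) = mul g (mul h k e₂) (e₁.trans (r_mul h k e₂).symm)
  inv_mul : ∀ g, mul (inv g) g (s_inv g) = one (s g)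
  mul_inv : ∀ g, mul g (inv g) (r_inv g).symm = one (r g)
  continuous_s : Continuous s
  continuous_r : Continuous r
  continuous_one : Continuous one
  continuous_inv : Continuous inv
  continuous_mul : Continuous fun p : {p : Arr × Arr // s p.1 = r p.2} => mul p.1.1 p.1.2 p.2
  /-- the Real structure on units -/
  ρ₀ : Obj → Obj
  /-- the Real structure on arrows -/
  ρ : Arr → Arr
  ρ₀_ρ₀ : ∀ x, ρ₀ (ρ₀ x) = x
  ρ_ρ : ∀ g, ρ (ρ g) = g
  continuous_ρ₀ : Continuous ρ₀
  continuous_ρ : Continuous ρ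
  s_ρ : ∀ g, s (ρ g) = ρ₀ (s g)
  r_ρ : ∀ g, r (ρ g) = ρ₀ (r g)
  ρ_one : ∀ x, ρ (one x) = one (ρ₀ x)
  ρ_mul : ∀ g h (e : s g = r h),
    ρ (mul g h e) = mul (ρ g) (ρ h) ((s_ρ g).trans ((congrArg ρ₀ e).trans (r_ρ h).symm))

attribute [instance] RealGroupoid.topObj RealGroupoid.topArr

/-! ### Real simplicial spaces and the nerve of a Real groupoid -/

/-- A Real simplicial space: a contravariant functor from the simplex category (objects
`[n] = Fin (n + 1)`, morphisms the nondecreasing maps) to spaces with involution. -/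
structure RealSimplicialSpace : Type (u + 1) where
  X : ℕ → Type u
  [top : ∀ n, TopologicalSpace (X n)]
  ρ : ∀ n, X n → X n
  ρ_ρ : ∀ n x, ρ n (ρ n x) = x
  continuous_ρ : ∀ n, Continuous (ρ n)
  map : ∀ {m n : ℕ}, (Fin (m + 1) →o Fin (n + 1)) → X n → X m
  continuous_map : ∀ {m n : ℕ} (f : Fin (m + 1) →o Fin (n + 1)), Continuous (map f)
  map_id : ∀ {n : ℕ} (x : X n), map OrderHom.id x = x
  map_comp : ∀ {l m n : ℕ} (f : Fin (m + 1) →o Fin (n + 1)) (g : Fin (l + 1) →o Fin (m + 1))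
    (x : X n), map (f.comp g) x = map g (map f x)
  map_ρ : ∀ {m n : ℕ} (f : Fin (m + 1) →o Fin (n + 1)) (x : X n), map f (ρ n x) = ρ m (map f x)

attribute [instance] RealSimplicialSpace.top

namespace RealGroupoid

/-- `𝒢ₙ`: strict morphisms from the pair groupoid `[n] × [n] ⇉ [n]` to `𝒢`, where
`r (i, j) = i`, `s (i, j) = j` and `(i, j) (j, k) = (i, k)`. -/
@[ext] structure NerveObj (G : RealGroupoid.{u}) (n : ℕ) : Type u where
  obj : Fin (n + 1) → G.Obj
  arr : Fin (n + 1) → Fin (n + 1) → G.Arr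
  s_arr : ∀ i j, G.s (arr i j) = obj j
  r_arr : ∀ i j, G.r (arr i j) = obj i
  arr_self : ∀ i, arr i i = G.one (obj i)
  arr_mul : ∀ i j k, G.mul (arr i j) (arr j k) ((s_arr i j).trans (r_arr j k).symm) = arr i k

variable (G : RealGroupoid.{u})

/-- The topology of pointwise convergence. -/
instance (n : ℕ) : TopologicalSpace (G.NerveObj n) :=
  TopologicalSpace.induced (fun a => (a.obj, a.arr)) inferInstance

theorem NerveObj.continuous_obj {n : ℕ} (i : Fin (n + 1)) :
    Continuous fun a : G.NerveObj n => a.obj i :=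
  (continuous_apply i).comp (continuous_fst.comp
    (continuous_induced_dom (f := fun a : G.NerveObj n => (a.obj, a.arr))))

theorem NerveObj.continuous_arr {n : ℕ} (i j : Fin (n + 1)) :
    Continuous fun a : G.NerveObj n => a.arr i j :=
  (continuous_apply_apply i j).comp (continuous_snd.comp
    (continuous_induced_dom (f := fun a : G.NerveObj n => (a.obj, a.arr))))

/-- The Real simplicial space `𝒢_•`. -/
def nerve : RealSimplicialSpace.{u} where
  X n := G.NerveObj n
  ρ n a :=
    { obj := fun i => G.ρ₀ (a.obj i)
      arr := fun i j => G.ρ (a.arr i j)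
      s_arr := fun i j => by rw [G.s_ρ, a.s_arr]
      r_arr := fun i j => by rw [G.r_ρ, a.r_arr]
      arr_self := fun i => by rw [a.arr_self, G.ρ_one]
      arr_mul := fun i j k => by
        rw [← G.ρ_mul _ _ ((a.s_arr i j).trans (a.r_arr j k).symm), a.arr_mul] }
  ρ_ρ n a := by ext <;> simp [G.ρ_ρ, G.ρ₀_ρ₀]
  continuous_ρ n := continuous_induced_rng.2 <| Continuous.prodMk
    (continuous_pi fun i => G.continuous_ρ₀.comp (NerveObj.continuous_obj G i))
    (continuous_pi fun i => continuous_pi fun j =>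
      G.continuous_ρ.comp (NerveObj.continuous_arr G i j))
  map f a :=
    { obj := fun i => a.obj (f i)
      arr := fun i j => a.arr (f i) (f j)
      s_arr := fun _ _ => a.s_arr _ _
      r_arr := fun _ _ => a.r_arr _ _
      arr_self := fun _ => a.arr_self _
      arr_mul := fun _ _ _ => a.arr_mul _ _ _ }
  continuous_map f := continuous_induced_rng.2 <| Continuous.prodMk
    (continuous_pi fun i => NerveObj.continuous_obj G (f i))
    (continuous_pi fun i => continuous_pi fun j => NerveObj.continuous_arr G (f i) (f j))
  map_id _ := rfl
  map_comp _ _ _ := rfl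
  map_ρ _ _ := rfl

end RealGroupoid

/-! ### Real open covers -/

/-- A Real open cover of a Real simplicial space: for every `n` an open cover of `Xₙ`, indexed by
a set with involution `j ↦ bar j` such that `U (bar j) = ρ (U j)`. -/
structure RealCover (𝒳 : RealSimplicialSpace.{u}) : Type (u + 1) where
  J : ℕ → Type u
  bar : ∀ n, J n → J n
  bar_bar : ∀ n j, bar n (bar n j) = j
  U : ∀ n, J n → Set (𝒳.X n)
  isOpen_U : ∀ n j, IsOpen (U n j)
  U_bar : ∀ n j, U n (bar n j) = 𝒳.ρ n '' U n j
  exists_mem : ∀ n x, ∃ j, x ∈ U n j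

/-- A pre-simplicial Real open cover: the index sets form a pre-simplicial set with involutions
(`face f` for increasing `f`), compatibly with the covers. -/
structure PresimplicialCover (𝒳 : RealSimplicialSpace.{u}) : Type (u + 1)
    extends RealCover 𝒳 where
  face : ∀ {m n : ℕ}, (Fin (m + 1) ↪o Fin (n + 1)) → J n → J m
  face_id : ∀ {n : ℕ} (j : J n), face (RelEmbedding.refl _) j = j
  face_comp : ∀ {l m n : ℕ} (f : Fin (m + 1) ↪o Fin (n + 1)) (g : Fin (l + 1) ↪o Fin (m + 1))
    (j : J n), face (g.trans f) j = face g (face f j)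
  face_bar : ∀ {m n : ℕ} (f : Fin (m + 1) ↪o Fin (n + 1)) (j : J n),
    face f (bar n j) = bar m (face f j)
  map_mem : ∀ {m n : ℕ} (f : Fin (m + 1) ↪o Fin (n + 1)) (j : J n) (x : 𝒳.X n),
    x ∈ U n j → 𝒳.map f.toOrderHom x ∈ U m (face f j)

/-- `V` is finer than `U` via the Real maps `θ n`. -/
structure Refinement {𝒳 : RealSimplicialSpace.{u}} (U V : RealCover 𝒳) : Type u where
  θ : ∀ n, V.J n → U.J n
  θ_bar : ∀ n j, θ n (V.bar n j) = U.bar n (θ n j)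
  subset : ∀ n j, V.U n j ⊆ U.U n (θ n j)

namespace RealCover

variable {𝒳 : RealSimplicialSpace.{u}} (U : RealCover 𝒳)

theorem ρ_mem {n : ℕ} {j : U.J n} {x : 𝒳.X n} (hx : x ∈ U.U n j) :
    𝒳.ρ n x ∈ U.U n (U.bar n j) := by
  rw [U.U_bar]; exact ⟨x, hx, rfl⟩

/-- The `N`-skeleton of the cover admits an `N`-simplicial Real structure. -/
def AdmitsSimplicial (N : ℕ) : Prop :=
  ∃ F : ∀ m n : ℕ, m ≤ N → n ≤ N → (Fin (m + 1) →o Fin (n + 1)) → U.J n → U.J m,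
    (∀ n (hn : n ≤ N) j, F n n hn hn OrderHom.id j = j) ∧
    (∀ l m n (hl : l ≤ N) (hm : m ≤ N) (hn : n ≤ N)
      (f : Fin (m + 1) →o Fin (n + 1)) (g : Fin (l + 1) →o Fin (m + 1)) (j : U.J n),
      F l n hl hn (f.comp g) j = F l m hl hm g (F m n hm hn f j)) ∧
    (∀ m n (hm : m ≤ N) (hn : n ≤ N) (f : Fin (m + 1) →o Fin (n + 1)) (j : U.J n),
      F m n hm hn f (U.bar n j) = U.bar m (F m n hm hn f j)) ∧
    (∀ m n (hm : m ≤ N) (hn : n ≤ N) (f : Fin (m + 1) →o Fin (n + 1)) (j : U.J n) (x : 𝒳.X n),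
      x ∈ U.U n j → 𝒳.map f x ∈ U.U m (F m n hm hn f j))

/-- The pre-simplicial Real open cover `♮U` associated with `U`: its `n`-th index set consists of
the families `l` with `l φ ∈ J k` for each increasing `φ : [k] → [n]`, and
`U l = ⋂ φ, φ̃⁻¹ (U (l φ))`. -/
def natural : PresimplicialCover 𝒳 where
  J n := ∀ k, (Fin (k + 1) ↪o Fin (n + 1)) → U.J k
  bar n l := fun k φ => U.bar k (l k φ)
  bar_bar n l := by funext k φ; exact U.bar_bar k _
  U n l := {x | ∀ k φ, 𝒳.map φ.toOrderHom x ∈ U.U k (l k φ)}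
  isOpen_U n l := by
    have : {x | ∀ k φ, 𝒳.map φ.toOrderHom x ∈ U.U k (l k φ)} =
        ⋂ k ∈ Finset.range (n + 1), ⋂ φ : Fin (k + 1) ↪o Fin (n + 1),
          𝒳.map φ.toOrderHom ⁻¹' U.U k (l k φ) := by
      ext x
      simp only [Set.mem_ofPred_eq, Set.mem_iInter, Set.mem_preimage, Finset.mem_range]
      refine ⟨fun h k _ φ => h k φ, fun h k φ => h k ?_ φ⟩
      simpa using Fintype.card_le_of_injective φ φ.injective
    rw [this]
    exact isOpen_biInter_finset fun k _ => isOpen_iInter_of_finite fun φ =>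
      (U.isOpen_U k _).preimage (𝒳.continuous_map _)
  U_bar n l := by
    ext x
    constructor
    · intro hx
      refine ⟨𝒳.ρ n x, fun k φ => ?_, 𝒳.ρ_ρ n x⟩
      have := U.ρ_mem (hx k φ)
      rw [U.bar_bar] at this
      rwa [𝒳.map_ρ]
    · rintro ⟨y, hy, rfl⟩ k φ
      rw [𝒳.map_ρ]
      exact U.ρ_mem (hy k φ)
  exists_mem n x := by
    choose l hl using fun (k : ℕ) (φ : Fin (k + 1) ↪o Fin (n + 1)) =>
      U.exists_mem k (𝒳.map φ.toOrderHom x)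
    exact ⟨l, hl⟩
  face f l := fun k φ => l k (φ.trans f)
  face_id l := rfl
  face_comp f g l := rfl
  face_bar f l := rfl
  map_mem f l x hx k φ := by
    rw [← 𝒳.map_comp]
    exact hx k (φ.trans f)

end RealCover

namespace Refinement

variable {𝒳 : RealSimplicialSpace.{u}}

/-- A refinement of pre-simplicial covers is pre-simplicial if it commutes with the faces. -/
def IsPresimplicial {P Q : PresimplicialCover 𝒳}
    (θ : Refinement P.toRealCover Q.toRealCover) : Prop :=
  ∀ {m n : ℕ} (f : Fin (m + 1) ↪o Fin (n + 1)) (j : Q.J n),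
    θ.θ m (Q.face f j) = P.face f (θ.θ n j)

/-- The refinement of the associated pre-simplicial covers. -/
def natural {U V : RealCover 𝒳} (θ : Refinement U V) :
    Refinement U.natural.toRealCover V.natural.toRealCover where
  θ n l := fun k φ => θ.θ k (l k φ)
  θ_bar n l := by funext k φ; exact θ.θ_bar k _
  subset n l x hx := fun k φ => θ.subset k _ (hx k φ)

theorem natural_isPresimplicial {U V : RealCover 𝒳} (θ : Refinement U V) :
    θ.natural.IsPresimplicial (P := U.natural) (Q := V.natural) := fun _ _ => rfl

end Refinement

/-! ### Real Čech cohomology -/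

/-- An abelian topological group (written additively) with a Real structure. -/
structure RealAbGroup : Type 1 where
  S : Type
  [grp : AddCommGroup S]
  [top : TopologicalSpace S]
  [topGrp : IsTopologicalAddGroup S]
  conj : S →+ S
  continuous_conj : Continuous conj
  conj_conj : ∀ a, conj (conj a) = a

attribute [instance] RealAbGroup.grp RealAbGroup.top RealAbGroup.topGrp

/-- Complex conjugation on the circle group. -/
def circleConj : Circle →* Circle where
  toFun z := ⟨starRingEnd ℂ (z : ℂ), by
    simp [Submonoid.unitSphere, Circle.norm_coe]⟩
  map_one' := by ext; exact map_one (starRingEnd ℂ)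
  map_mul' a b := by ext; exact map_mul (starRingEnd ℂ) (a : ℂ) (b : ℂ)

/-- The circle group `𝕊¹` (in additive notation) with complex conjugation. -/
def RealAbGroup.circle : RealAbGroup where
  S := Additive Circle
  conj := MonoidHom.toAdditive circleConj
  continuous_conj := by
    refine continuous_ofMul.comp (Continuous.comp ?_ continuous_toMul)
    exact Continuous.subtype_mk (Complex.continuous_conj.comp continuous_subtype_val) _
  conj_conj a := by
    change Additive.ofMul (circleConj (circleConj a.toMul)) = a
    apply congrArg Additive.ofMul
    ext
    exact Complex.conj_conj (a.toMul : ℂ)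

namespace PresimplicialCover

variable {𝒳 : RealSimplicialSpace.{u}} (P : PresimplicialCover 𝒳) (S : RealAbGroup)

/-- Real `n`-cochains of a pre-simplicial Real open cover with coefficients in the Real sheaf of
germs of continuous `S`-valued functions: globally Real families of sections
`c j ∈ C(U j, S)`, that is `c (bar j) (ρ x) = conj (c j x)`. -/
def cochains (n : ℕ) : AddSubgroup (∀ j : P.J n, C(P.U n j, S.S)) where
  carrier := {c | ∀ (j : P.J n) (x : 𝒳.X n) (hx : x ∈ P.U n j),
    c (P.bar n j) ⟨𝒳.ρ n x, P.ρ_mem hx⟩ = S.conj (c j ⟨x, hx⟩)}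
  zero_mem' := fun j x hx => by simp
  add_mem' := fun {a b} ha hb j x hx => by simp [ha j x hx, hb j x hx]
  neg_mem' := fun {a} ha j x hx => by simp [ha j x hx]

/-- The map `f̃ : U j → U (f̃ j)` given by an increasing `f`. -/
def faceMap {m n : ℕ} (f : Fin (m + 1) ↪o Fin (n + 1)) (j : P.J n) :
    C(P.U n j, P.U m (P.face f j)) where
  toFun x := ⟨𝒳.map f.toOrderHom x.1, P.map_mem f j x.1 x.2⟩
  continuous_toFun :=
    ((𝒳.continuous_map f.toOrderHom).comp continuous_subtype_val).subtype_mk _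

theorem family_congr {n : ℕ} (c : ∀ j : P.J n, C(P.U n j, S.S)) {j j' : P.J n} (h : j = j')
    {x x' : 𝒳.X n} (hxx : x = x') (hx : x ∈ P.U n j) (hx' : x' ∈ P.U n j') :
    c j ⟨x, hx⟩ = c j' ⟨x', hx'⟩ := by
  subst h; subst hxx; rfl

/-- The differential `(d c) j = ∑ k, (-1) ^ k • ε̃ₖ^* (c (ε̃ₖ j))`, where `εₖ : [n] → [n + 1]`
is the increasing map that avoids `k`. -/
def d (n : ℕ) : P.cochains S n →+ P.cochains S (n + 1) where
  toFun c := ⟨fun j => ∑ k : Fin (n + 2), (-1 : ℤ) ^ (k : ℕ) •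
      (c.1 (P.face (Fin.succAboveOrderEmb k) j)).comp (P.faceMap (Fin.succAboveOrderEmb k) j), by
    intro j x hx
    simp only [ContinuousMap.coe_sum, ContinuousMap.coe_zsmul, Finset.sum_apply, Pi.smul_apply,
      ContinuousMap.comp_apply, map_sum, map_zsmul]
    refine Finset.sum_congr rfl fun k _ => ?_
    congr 1
    refine Eq.trans ?_ (c.2 _ _ (P.map_mem (Fin.succAboveOrderEmb k) j x hx))
    exact P.family_congr S c.1 (P.face_bar _ _) (𝒳.map_ρ _ _) _ _⟩
  map_zero' := by
    ext j x
    simp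
  map_add' a b := by
    ext j x
    simp [Finset.sum_add_distrib]

/-- Real `n`-cocycles. -/
def cocycles (n : ℕ) : AddSubgroup (P.cochains S n) := (P.d S n).ker

/-- Real `n`-coboundaries. -/
def coboundaries : ∀ n : ℕ, AddSubgroup (P.cochains S n)
  | 0 => ⊥
  | n + 1 => (P.d S n).range

/-- The `n`-th Real cohomology group `ker dⁿ / im dⁿ⁻¹` of a pre-simplicial Real open cover. -/
abbrev cohomology (n : ℕ) : Type u :=
  P.cocycles S n ⧸ (P.coboundaries S n).addSubgroupOf (P.cocycles S n)

end PresimplicialCover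

namespace Refinement

variable {𝒳 : RealSimplicialSpace.{u}} {P Q : PresimplicialCover 𝒳}
  (θ : Refinement P.toRealCover Q.toRealCover) (S : RealAbGroup)

/-- Pull-back of cochains along a refinement: `(θ^* c) j = c (θ j)` restricted to `V j`. -/
def pull (n : ℕ) : P.cochains S n →+ Q.cochains S n where
  toFun c := ⟨fun j => (c.1 (θ.θ n j)).comp (ContinuousMap.inclusion (θ.subset n j)), by
    intro j x hx
    refine Eq.trans ?_ (c.2 _ _ (θ.subset n j hx))
    exact P.family_congr S c.1 (θ.θ_bar n j) rfl _ _⟩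
  map_zero' := by ext j x; simp
  map_add' a b := by ext j x; simp

theorem d_pull (hθ : θ.IsPresimplicial) (n : ℕ) (c : P.cochains S n) :
    Q.d S n (θ.pull S n c) = θ.pull S (n + 1) (P.d S n c) := by
  ext j x
  simp only [PresimplicialCover.d, pull, AddMonoidHom.coe_mk, ZeroHom.coe_mk,
    ContinuousMap.coe_sum, ContinuousMap.coe_zsmul, Finset.sum_apply, Pi.smul_apply,
    ContinuousMap.comp_apply]
  refine Finset.sum_congr rfl fun k _ => ?_
  congr 1
  exact P.family_congr S c.1 (hθ _ _) rfl _ _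

/-- The homomorphism `θ^*` in cohomology. -/
def cohomologyMap (hθ : θ.IsPresimplicial) (n : ℕ) : P.cohomology S n →+ Q.cohomology S n :=
  QuotientAddGroup.map _ _
    (((θ.pull S n).comp (P.cocycles S n).subtype).codRestrict (Q.cocycles S n) (fun c => by
      have hc : P.d S n c.1 = 0 := c.2
      change Q.d S n (θ.pull S n c.1) = 0
      rw [θ.d_pull S hθ, hc, map_zero]))
    (by
      intro c hc
      have hc' : c.1 ∈ P.coboundaries S n := hc
      change θ.pull S n c.1 ∈ Q.coboundaries S n
      cases n with
      | zero =>
        have : c.1 = 0 := hc'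
        rw [this, map_zero]; exact zero_mem _
      | succ n =>
        obtain ⟨b, hb⟩ := hc'
        exact ⟨θ.pull S n b, by rw [θ.d_pull S hθ, hb]⟩)

end Refinement

/-- The collection `𝔑(n)` of Real open covers whose `N`-skeleton admits an `N`-simplicial Real
structure for some `N ≥ n + 1`. -/
def AdmissibleCover (𝒳 : RealSimplicialSpace.{u}) (n : ℕ) : Type (u + 1) :=
  {U : RealCover 𝒳 // ∃ N, n + 1 ≤ N ∧ U.AdmitsSimplicial N}

/-- The cohomology `HRⁿ(U, S)` of a Real open cover `U`: that of the associated pre-simplicial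
cover. -/
abbrev RealCover.HR {𝒳 : RealSimplicialSpace.{u}} (U : RealCover 𝒳) (S : RealAbGroup) (n : ℕ) :
    Type u :=
  U.natural.cohomology S n

open Classical in
/-- The subgroup of `⨁ HRⁿ(U, S)` that identifies `x ∈ HRⁿ(U, S)` with `θ^* x ∈ HRⁿ(V, S)` for
all refinements `V` of `U`. -/
def cechRelations (𝒳 : RealSimplicialSpace.{u}) (S : RealAbGroup) (n : ℕ) :
    AddSubgroup (⨁ U : AdmissibleCover 𝒳 n, U.1.HR S n) :=
  AddSubgroup.closure
    {z | ∃ (U V : AdmissibleCover 𝒳 n) (θ : Refinement U.1 V.1) (x : U.1.HR S n),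
      z = DirectSum.of (fun U : AdmissibleCover 𝒳 n => U.1.HR S n) U x -
          DirectSum.of (fun U : AdmissibleCover 𝒳 n => U.1.HR S n) V
            (θ.natural.cohomologyMap S θ.natural_isPresimplicial n x)}

/-- The Real Čech cohomology group `ȞRⁿ(𝒳, S)`: the inductive limit of `HRⁿ(U, S)` over
`U ∈ 𝔑(n)`, ordered by refinement. -/
abbrev CechHR (𝒳 : RealSimplicialSpace.{u}) (S : RealAbGroup) (n : ℕ) : Type (u + 1) :=
  (⨁ U : AdmissibleCover 𝒳 n, U.1.HR S n) ⧸ cechRelations 𝒳 S n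

/-! ### Real line bundles and the Real Picard group -/

/-- A Real line `𝒢`-bundle: a complex vector bundle `E` of rank one over the unit space, with a
continuous involution `ν` that covers `ρ` and is antilinear on the fibres, and a continuous
action of `𝒢`, linear on the fibres and compatible with the Real structures. The arrow `g`
from `x = s g` to `y = r g` acts as a map `E x → E y`. (The total space is automatically locally
compact Hausdorff, and the projection automatically an open surjection, when the unit space is
locally compact Hausdorff.  As a one-dimensional complex space is isomorphic to `ℂ`, taking the
fibres in `Type` does not restrict the isomorphism classes.) -/
structure RealLineBundle (G : RealGroupoid.{u}) : Type (max u 1) where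
  E : G.Obj → Type
  [addCommGroup : ∀ x, AddCommGroup (E x)]
  [module : ∀ x, Module ℂ (E x)]
  [topFiber : ∀ x, TopologicalSpace (E x)]
  [topTotal : TopologicalSpace (TotalSpace ℂ E)]
  [fiberBundle : FiberBundle ℂ E]
  [vectorBundle : VectorBundle ℂ ℂ E]
  ν : ∀ {x y : G.Obj}, G.ρ₀ x = y → (E x →ₛₗ[starRingEnd ℂ] E y)
  ν_ν : ∀ {x y : G.Obj} (h : G.ρ₀ x = y) (h' : G.ρ₀ y = x) (v : E x), ν h' (ν h v) = v
  continuous_ν : Continuous fun v : TotalSpace ℂ E =>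
    (⟨G.ρ₀ v.proj, ν rfl v.2⟩ : TotalSpace ℂ E)
  act : ∀ (g : G.Arr) {x y : G.Obj}, G.s g = x → G.r g = y → (E x →ₗ[ℂ] E y)
  act_one : ∀ (x : G.Obj) (v : E x), act (G.one x) (G.s_one x) (G.r_one x) v = v
  act_mul : ∀ (g h : G.Arr) {x y z : G.Obj} (hx : G.s h = x) (hy : G.r h = y) (gy : G.s g = y)
    (gz : G.r g = z) (v : E x),
    act (G.mul g h (gy.trans hy.symm)) ((G.s_mul g h _).trans hx) ((G.r_mul g h _).trans gz) v =
      act g gy gz (act h hx hy v)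
  act_ν : ∀ (g : G.Arr) {x y x' y' : G.Obj} (gx : G.s g = x) (gy : G.r g = y)
    (hx : G.ρ₀ x = x') (hy : G.ρ₀ y = y') (v : E x),
    act (G.ρ g) ((G.s_ρ g).trans ((congrArg G.ρ₀ gx).trans hx))
      ((G.r_ρ g).trans ((congrArg G.ρ₀ gy).trans hy)) (ν hx v) = ν hy (act g gx gy v)
  continuous_act : Continuous fun p : {p : G.Arr × TotalSpace ℂ E // G.s p.1 = p.2.proj} =>
    (⟨G.r p.1.1, act p.1.1 p.2 rfl p.1.2.2⟩ : TotalSpace ℂ E)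

attribute [instance] RealLineBundle.addCommGroup RealLineBundle.module RealLineBundle.topFiber
  RealLineBundle.topTotal RealLineBundle.fiberBundle RealLineBundle.vectorBundle

namespace RealLineBundle

variable {G : RealGroupoid.{u}}

/-- A homomorphism of Real line `𝒢`-bundles: a homomorphism of complex vector bundles that
intertwines the Real structures and is `𝒢`-equivariant. -/
structure Hom (L M : RealLineBundle G) : Type u where
  f : ∀ x, L.E x →ₗ[ℂ] M.E x
  continuous_f : Continuous fun v : TotalSpace ℂ L.E => (⟨v.proj, f v.proj v.2⟩ : TotalSpace ℂ M.E)
  f_ν : ∀ {x y : G.Obj} (h : G.ρ₀ x = y) (v : L.E x), f y (L.ν h v) = M.ν h (f x v)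
  f_act : ∀ (g : G.Arr) {x y : G.Obj} (gx : G.s g = x) (gy : G.r g = y) (v : L.E x),
    f y (L.act g gx gy v) = M.act g gx gy (f x v)

/-- Two Real line `𝒢`-bundles are isomorphic: there are mutually inverse homomorphisms. -/
def Isomorphic (L M : RealLineBundle G) : Prop :=
  ∃ (φ : Hom L M) (ψ : Hom M L), (∀ x v, ψ.f x (φ.f x v) = v) ∧ (∀ x v, φ.f x (ψ.f x v) = v)

theorem isomorphic_equivalence : Equivalence (Isomorphic (G := G)) where
  refl L := by
    let φ : Hom L L :=
      { f := fun _ => LinearMap.id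
        continuous_f := continuous_id
        f_ν := fun _ _ => rfl
        f_act := fun _ _ _ _ _ _ => rfl }
    exact ⟨φ, φ, fun _ _ => rfl, fun _ _ => rfl⟩
  symm := fun ⟨φ, ψ, h₁, h₂⟩ => ⟨ψ, φ, h₂, h₁⟩
  trans := fun ⟨φ, ψ, h₁, h₂⟩ ⟨φ', ψ', h₁', h₂'⟩ =>
    ⟨{ f := fun x => (φ'.f x).comp (φ.f x)
       continuous_f := φ'.continuous_f.comp φ.continuous_f
       f_ν := fun h v => by simp [φ.f_ν, φ'.f_ν]
       f_act := fun g _ _ gx gy v => by simp [φ.f_act, φ'.f_act] },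
     { f := fun x => (ψ.f x).comp (ψ'.f x)
       continuous_f := ψ.continuous_f.comp ψ'.continuous_f
       f_ν := fun h v => by simp [ψ.f_ν, ψ'.f_ν]
       f_act := fun g _ _ gx gy v => by simp [ψ.f_act, ψ'.f_act] },
     fun x v => by simp [h₁, h₁'], fun x v => by simp [h₂, h₂']⟩

/-- Local triviality: there are a Real open cover `(U j)` of the unit space and linear
trivializations `e j` over `U j` (the inverses of the isomorphisms `φ j : U j × ℂ → L|_{U j}`)
with `φ (bar j) (ρ x, conj z) = ν (φ j (x, z))`. -/
def IsLocallyTrivial (L : RealLineBundle G) : Prop :=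
  ∃ (J : Type u) (bar : J → J) (U : J → Set G.Obj)
    (e : J → Trivialization ℂ (TotalSpace.proj : TotalSpace ℂ L.E → G.Obj)),
    (∀ j, bar (bar j) = j) ∧ (∀ j, IsOpen (U j)) ∧ (∀ j, U (bar j) = G.ρ₀ '' U j) ∧
    (∀ x, ∃ j, x ∈ U j) ∧
    (∀ j, (e j).baseSet = U j ∧ (e j).IsLinear ℂ) ∧
    (∀ j (x y : G.Obj) (h : G.ρ₀ x = y) (v : L.E x), x ∈ U j →
      (e (bar j) ⟨y, L.ν h v⟩).2 = starRingEnd ℂ (e j ⟨x, v⟩).2)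

end RealLineBundle

/-- A locally trivial hermitian Real line `𝒢`-bundle: it carries a continuous, Real,
`𝒢`-invariant hermitian metric `h`. -/
structure HermitianRealLineBundle (G : RealGroupoid.{u}) : Type (max u 1)
    extends RealLineBundle G where
  locallyTrivial : toRealLineBundle.IsLocallyTrivial
  h : TotalSpace ℂ E → ℝ
  continuous_h : Continuous h
  h_ν : ∀ {x y : G.Obj} (e : G.ρ₀ x = y) (v : E x), h ⟨y, ν e v⟩ = h ⟨x, v⟩
  h_smul : ∀ (x : G.Obj) (z : ℂ) (v : E x), h ⟨x, z • v⟩ = h ⟨x, v⟩ * ‖z‖ ^ 2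
  h_act : ∀ (g : G.Arr) {x y : G.Obj} (gx : G.s g = x) (gy : G.r g = y) (v : E x),
    h ⟨y, act g gx gy v⟩ = h ⟨x, v⟩
  h_pos : ∀ (x : G.Obj) (v : E x), v ≠ 0 → 0 < h ⟨x, v⟩

namespace HermitianRealLineBundle

variable {G : RealGroupoid.{u}}

/-- `M` is a tensor product of `L` and `L'`: there is a continuous family of bilinear maps
`L_x × L'_x → M_x`, compatible with Real structures and `𝒢`-actions, that exhibits `M_x` as
`L_x ⊗ L'_x`. -/
def IsTensor (L L' M : HermitianRealLineBundle G) : Prop :=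
  ∃ β : ∀ x, L.E x →ₗ[ℂ] L'.E x →ₗ[ℂ] M.E x,
    (∀ x, IsTensorProduct (β x)) ∧
    (Continuous fun p : TotalSpace (ℂ × ℂ) (L.E ×ᵇ L'.E) =>
      (⟨p.proj, β p.proj p.2.1 p.2.2⟩ : TotalSpace ℂ M.E)) ∧
    (∀ (x y : G.Obj) (e : G.ρ₀ x = y) (v : L.E x) (w : L'.E x),
      β y (L.ν e v) (L'.ν e w) = M.ν e (β x v w)) ∧
    (∀ (g : G.Arr) (x y : G.Obj) (gx : G.s g = x) (gy : G.r g = y) (v : L.E x) (w : L'.E x),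
      β y (L.act g gx gy v) (L'.act g gx gy w) = M.act g gx gy (β x v w))

/-- Isomorphism as Real line `𝒢`-bundles. -/
instance isoSetoid (G : RealGroupoid.{u}) : Setoid (HermitianRealLineBundle G) where
  r L M := L.toRealLineBundle.Isomorphic M.toRealLineBundle
  iseqv :=
    ⟨fun _ => RealLineBundle.isomorphic_equivalence.refl _,
     fun h => RealLineBundle.isomorphic_equivalence.symm h,
     fun h h' => RealLineBundle.isomorphic_equivalence.trans h h'⟩

end HermitianRealLineBundle

/-- The Real Picard group as a set: the isomorphism classes of locally trivial hermitian Real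
line `𝒢`-bundles. -/
def PicR (G : RealGroupoid.{u}) : Type (max u 1) :=
  Quotient (HermitianRealLineBundle.isoSetoid G)

/-- The class of a bundle in the Real Picard group. -/
def PicR.mk {G : RealGroupoid.{u}} (L : HermitianRealLineBundle G) : PicR G :=
  Quotient.mk (HermitianRealLineBundle.isoSetoid G) L

end

/-!
A Real line bundle is measured by one nowhere vanishing section that is not required to be
continuous. The section has three kinds of multipliers: how the arrows act on it, how the Real
structure acts on it, and how it differs near each point from a continuous section. Rescaling the
section changes the multipliers by those of a section of the trivial bundle, so their class in a
fixed group is an invariant of the bundle. It determines the bundle, because matching multipliers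
are exactly what turns the map sending one section to the other into an isomorphism, and it turns
tensor products into sums.

A Real `1`-cocycle has an invariant in the same group, read off in the same way from an arbitrary
selection of an index at every unit. As the selection does not have to respect any cover, cocycles
on different covers are compared without common refinements, and the invariant is injective on the
inductive limit. Bundles and cocycles have the same invariants, namely those of transition data
over covers of the unit space.
-/

noncomputable section

open Topology Filter


/-! ### Simplices of the nerve -/

namespace RealGroupoid

variable (G : RealGroupoid.{u})

theorem mul_congr {g g' h h' : G.Arr} (hg : g = g') (hh : h = h') (e : G.s g = G.r h)
    (e' : G.s g' = G.r h') : G.mul g h e = G.mul g' h' e' := by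
  subst hg; subst hh; rfl

theorem one_mul_of_eq {g : G.Arr} {x : G.Obj} (hx : G.r g = x) (e : G.s (G.one x) = G.r g) :
    G.mul (G.one x) g e = g := by
  subst hx; exact G.one_mul g

theorem mul_one_of_eq {g : G.Arr} {x : G.Obj} (hx : G.s g = x) (e : G.s g = G.r (G.one x)) :
    G.mul g (G.one x) e = g := by
  subst hx; exact G.mul_one g

theorem eq_inv_of_mul_eq_one {g h : G.Arr} (e : G.s g = G.r h)
    (hgh : G.mul g h e = G.one (G.r g)) : h = G.inv g := by
  have assoc := G.mul_assoc (G.inv g) g h (G.s_inv g) e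
  rwa [G.mul_congr (G.inv_mul g) rfl _ ((G.s_one _).trans e), G.one_mul_of_eq e.symm,
    G.mul_congr rfl hgh _ ((G.s_inv g).trans (G.r_one _).symm),
    G.mul_one_of_eq (G.s_inv g)] at assoc

protected theorem inv_one (x : G.Obj) : G.inv (G.one x) = G.one x := by
  refine (G.eq_inv_of_mul_eq_one ((G.s_one x).trans (G.r_one x).symm) ?_).symm
  rw [G.mul_one_of_eq (G.s_one x), G.r_one]

protected theorem inv_inv (g : G.Arr) : G.inv (G.inv g) = g :=
  (G.eq_inv_of_mul_eq_one (G.s_inv g) ((G.inv_mul g).trans (by rw [G.r_inv]))).symm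

/-- The simplex of the nerve determined by arrows `γ 0, …, γ n` with common source: its edges are
the arrows `γ i (γ j)⁻¹`. -/
def simplex {n : ℕ} (γ : Fin (n + 1) → G.Arr) (z : G.Obj) (hz : ∀ i, G.s (γ i) = z) :
    G.NerveObj n where
  obj i := G.r (γ i)
  arr i j := G.mul (γ i) (G.inv (γ j)) ((hz i).trans ((G.r_inv _).trans (hz j)).symm)
  s_arr i j := (G.s_mul _ _ _).trans (G.s_inv _)
  r_arr i j := G.r_mul _ _ _
  arr_self i := G.mul_inv _
  arr_mul i j k := by
    rw [G.mul_assoc _ _ _ _ (by rw [G.s_inv, G.r_mul])]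
    refine G.mul_congr rfl ?_ _ _
    rw [← G.mul_assoc _ _ _ (G.s_inv _) ((hz j).trans ((G.r_inv _).trans (hz k)).symm),
      G.mul_congr (G.inv_mul _) rfl _ (by rw [G.s_one, hz, G.r_inv, hz]),
      G.one_mul_of_eq (by rw [G.r_inv, hz, hz])]

theorem continuous_simplex {Y : Type*} [TopologicalSpace Y] {n : ℕ}
    {γ : Y → Fin (n + 1) → G.Arr} {z : Y → G.Obj} (hz : ∀ y i, G.s (γ y i) = z y)
    (hγ : ∀ i, Continuous fun y => γ y i) :
    Continuous fun y => G.simplex (γ y) (z y) (hz y) :=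
  continuous_induced_rng.2 <| Continuous.prodMk
    (continuous_pi fun i => G.continuous_r.comp (hγ i))
    (continuous_pi fun i => continuous_pi fun j =>
      G.continuous_mul.comp (((hγ i).prodMk (G.continuous_inv.comp (hγ j))).subtype_mk
        fun y => (hz y i).trans ((G.r_inv _).trans (hz y j)).symm))

/-- The vertex of the nerve given by a unit. -/
def vertex (x : G.Obj) : G.NerveObj 0 where
  obj _ := x
  arr _ _ := G.one x
  s_arr _ _ := G.s_one x
  r_arr _ _ := G.r_one x
  arr_self _ := rfl
  arr_mul _ _ _ := G.one_mul_of_eq (G.r_one x) _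

/-- The edge of the nerve given by an arrow `g`, with vertices `r g` and `s g`. -/
def edge (g : G.Arr) : G.NerveObj 1 :=
  G.simplex ![g, G.one (G.s g)] (G.s g) (Fin.forall_fin_two.2 ⟨rfl, G.s_one _⟩)

/-- The triangle of the nerve given by a composable pair `g, h`, with vertices `r g`,
`s g = r h` and `s h`. -/
def triangle (g h : G.Arr) (e : G.s g = G.r h) : G.NerveObj 2 :=
  G.simplex ![g, G.one (G.s g), G.inv h] (G.s g) (by
    simp [Fin.forall_fin_succ, G.s_one, G.s_inv, e])

theorem edge_arr (g : G.Arr) : (G.edge g).arr 0 1 = g :=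
  (G.mul_congr rfl (G.inv_one _) _ (G.r_one _).symm).trans (G.mul_one g)

theorem edge_obj_zero (g : G.Arr) : (G.edge g).obj 0 = G.r g := rfl

theorem edge_obj_one (g : G.Arr) : (G.edge g).obj 1 = G.s g := G.r_one _

section Triangle

variable (g h : G.Arr) (e : G.s g = G.r h)

theorem triangle_obj_zero : (G.triangle g h e).obj 0 = G.r g := rfl

theorem triangle_obj_one : (G.triangle g h e).obj 1 = G.s g := G.r_one _

theorem triangle_obj_two : (G.triangle g h e).obj 2 = G.s h := G.r_inv _

theorem triangle_arr_zero_one : (G.triangle g h e).arr 0 1 = g := G.edge_arr g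

theorem triangle_arr_one_two : (G.triangle g h e).arr 1 2 = h :=
  (G.mul_congr rfl (G.inv_inv h) _ ((G.s_one _).trans e)).trans (G.one_mul_of_eq e.symm _)

theorem triangle_arr_zero_two : (G.triangle g h e).arr 0 2 = G.mul g h e :=
  G.mul_congr rfl (G.inv_inv h) _ e

end Triangle

theorem eq_vertex (a : G.NerveObj 0) : a = G.vertex (a.obj 0) := by
  ext i j
  · rw [Subsingleton.elim (α := Fin 1) i 0]; rfl
  · rw [Subsingleton.elim (α := Fin 1) i 0, Subsingleton.elim (α := Fin 1) j 0]
    exact a.arr_self 0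

variable {G} in
theorem NerveObj.arr_one_zero (a : G.NerveObj 1) : a.arr 1 0 = G.inv (a.arr 0 1) :=
  G.eq_inv_of_mul_eq_one ((a.s_arr 0 1).trans (a.r_arr 1 0).symm)
    ((a.arr_mul 0 1 0).trans ((a.arr_self 0).trans (by rw [a.r_arr])))

variable {G} in
theorem NerveObj.ext_edge {a b : G.NerveObj 1} (h : a.arr 0 1 = b.arr 0 1) : a = b := by
  have h₀ : a.obj 0 = b.obj 0 := by rw [← a.r_arr 0 1, h, b.r_arr]
  have h₁ : a.obj 1 = b.obj 1 := by rw [← a.s_arr 0 1, h, b.s_arr]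
  apply NerveObj.ext (funext (Fin.forall_fin_two.2 ⟨h₀, h₁⟩))
  funext i j
  fin_cases i <;> fin_cases j
  · exact (a.arr_self 0).trans ((congrArg G.one h₀).trans (b.arr_self 0).symm)
  · exact h
  · exact a.arr_one_zero.trans ((congrArg G.inv h).trans b.arr_one_zero.symm)
  · exact (a.arr_self 1).trans ((congrArg G.one h₁).trans (b.arr_self 1).symm)

theorem eq_edge (a : G.NerveObj 1) : a = G.edge (a.arr 0 1) :=
  NerveObj.ext_edge (G.edge_arr _).symm

theorem map_eq_vertex {n : ℕ} (f : Fin 1 →o Fin (n + 1)) (a : G.NerveObj n) :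
    G.nerve.map f a = G.vertex (a.obj (f 0)) :=
  G.eq_vertex _

theorem map_eq_edge {n : ℕ} (f : Fin 2 →o Fin (n + 1)) (a : G.NerveObj n) :
    G.nerve.map f a = G.edge (a.arr (f 0) (f 1)) :=
  G.eq_edge _

theorem continuous_vertex : Continuous G.vertex :=
  continuous_induced_rng.2 <| Continuous.prodMk (continuous_pi fun _ => continuous_id)
    (continuous_pi fun _ => continuous_pi fun _ => G.continuous_one)

theorem continuous_edge : Continuous G.edge :=
  G.continuous_simplex _
    (Fin.forall_fin_two.2 ⟨continuous_id, G.continuous_one.comp G.continuous_s⟩)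

theorem vertex_ρ (x : G.Obj) : G.vertex (G.ρ₀ x) = G.nerve.ρ 0 (G.vertex x) :=
  (G.eq_vertex (G.nerve.ρ 0 (G.vertex x))).symm

theorem edge_ρ (g : G.Arr) : G.edge (G.ρ g) = G.nerve.ρ 1 (G.edge g) :=
  NerveObj.ext_edge ((G.edge_arr _).trans (congrArg G.ρ (G.edge_arr g)).symm)

end RealGroupoid

/-! ### Transition data and their section classes -/

/-- An open cover of the unit space, indexed by a set with involution `bar` such that
`U (bar j) = ρ₀ (U j)`: the covers that occur in the local triviality of Real bundles. -/
structure UnitCover (G : RealGroupoid.{u}) : Type (u + 1) where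
  J : Type u
  bar : J → J
  bar_bar : ∀ j, bar (bar j) = j
  U : J → Set G.Obj
  isOpen_U : ∀ j, IsOpen (U j)
  U_bar : ∀ j, U (bar j) = G.ρ₀ '' U j
  exists_mem : ∀ x, ∃ j, x ∈ U j

namespace UnitCover

variable {G : RealGroupoid.{u}} (𝒰 : UnitCover G)

theorem ρ_mem {j : 𝒰.J} {x : G.Obj} (hx : x ∈ 𝒰.U j) : G.ρ₀ x ∈ 𝒰.U (𝒰.bar j) := by
  rw [𝒰.U_bar]; exact ⟨x, hx, rfl⟩

/-- An index of a member of the cover that contains `x`, chosen without any continuity. -/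
def idx (x : G.Obj) : 𝒰.J := (𝒰.exists_mem x).choose

theorem mem_idx (x : G.Obj) : x ∈ 𝒰.U (𝒰.idx x) := (𝒰.exists_mem x).choose_spec

theorem eventually_mem {j : 𝒰.J} {x : G.Obj} (hx : x ∈ 𝒰.U j) : ∀ᶠ y in 𝓝 x, y ∈ 𝒰.U j :=
  (𝒰.isOpen_U j).mem_nhds hx

end UnitCover

/-- Multipliers over a cover of the unit space, the common shape of the transition functions of a
Real line bundle and of a Real `1`-cocycle: if `e j` is a frame over `U j`, then an arrow `g`
maps `e b (s g)` to `c a b g` times `e a (r g)`. The values of `c a b` at arrows with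
`r g ∉ U a` or `s g ∉ U b` are irrelevant. -/
structure TransitionData (G : RealGroupoid.{u}) (S : RealAbGroup) : Type (u + 1)
    extends UnitCover G where
  c : J → J → G.Arr → S.S
  c_mul : ∀ a b d g h (e : G.s g = G.r h), G.r g ∈ U a → G.s g ∈ U b → G.s h ∈ U d →
    c a d (G.mul g h e) = c a b g + c b d h
  c_ρ : ∀ a b g, G.r g ∈ U a → G.s g ∈ U b → c (bar a) (bar b) (G.ρ g) = S.conj (c a b g)
  continuousOn_c : ∀ a b, ContinuousOn (c a b) {g | G.r g ∈ U a ∧ G.s g ∈ U b}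

/-- The invariants of an arbitrary, possibly discontinuous, unit section `σ` of a Real line bundle:
`arrow g` compares `g · σ (s g)` with `σ (r g)`, `real x` compares `ν (σ x)` with `σ (ρ₀ x)`,
and `germ x y` compares a section that is continuous near `x` with `σ`, at the point `y`. -/
abbrev SectionData (G : RealGroupoid.{u}) (S : RealAbGroup) : Type u :=
  (G.Arr → S.S) × (G.Obj → S.S) × (G.Obj → G.Obj → S.S)

namespace SectionData

variable {G : RealGroupoid.{u}} {S : RealAbGroup}

/-- The multipliers of the groupoid action. -/
abbrev arrow (p : SectionData G S) : G.Arr → S.S := p.1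

/-- The multipliers of the Real structure. -/
abbrev real (p : SectionData G S) : G.Obj → S.S := p.2.1

/-- The multipliers of the continuous local sections. -/
abbrev germ (p : SectionData G S) : G.Obj → G.Obj → S.S := p.2.2

theorem arrow_add (p q : SectionData G S) (g : G.Arr) :
    (p + q).arrow g = p.arrow g + q.arrow g := rfl

theorem real_add (p q : SectionData G S) (x : G.Obj) :
    (p + q).real x = p.real x + q.real x := rfl

theorem germ_add (p q : SectionData G S) (x y : G.Obj) :
    (p + q).germ x y = p.germ x y + q.germ x y := rfl

/-- The data of the arbitrary sections `f` of the trivial bundle. -/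
def trivial (G : RealGroupoid.{u}) (S : RealAbGroup) : AddSubgroup (SectionData G S) where
  carrier := {p | ∃ f : G.Obj → S.S, (∀ g, p.arrow g + f (G.r g) = f (G.s g)) ∧
    (∀ x, p.real x + f (G.ρ₀ x) = S.conj (f x)) ∧
    ∀ x, ContinuousAt (fun y => p.germ x y + f y) x}
  zero_mem' := ⟨0, fun _ => add_zero _, fun _ => (add_zero _).trans (map_zero _).symm,
    fun _ => continuousAt_const⟩
  add_mem' := by
    rintro p q ⟨f, hf₁, hf₂, hf₃⟩ ⟨f', hf'₁, hf'₂, hf'₃⟩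
    refine ⟨f + f', fun g => ?_, fun x => ?_, fun x => ?_⟩
    · exact (add_add_add_comm _ _ _ _).trans (congrArg₂ _ (hf₁ g) (hf'₁ g))
    · simp only [Pi.add_apply, map_add, ← hf₂, ← hf'₂]
      exact add_add_add_comm _ _ _ _
    · refine ((hf₃ x).add (hf'₃ x)).congr (.of_forall fun y => ?_)
      exact add_add_add_comm _ _ _ _
  neg_mem' := by
    rintro p ⟨f, hf₁, hf₂, hf₃⟩
    refine ⟨-f, fun g => ?_, fun x => ?_, fun x => ?_⟩
    · exact (neg_add _ _).symm.trans (congrArg _ (hf₁ g))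
    · simp only [Pi.neg_apply, map_neg, ← hf₂]
      exact (neg_add _ _).symm
    · exact (hf₃ x).neg.congr (.of_forall fun y => neg_add _ _)

end SectionData

/-- Section data up to a change of the section. -/
abbrev SectionClass (G : RealGroupoid.{u}) (S : RealAbGroup) : Type u :=
  SectionData G S ⧸ SectionData.trivial G S

theorem SectionClass.mk_eq_mk_iff {G : RealGroupoid.{u}} {S : RealAbGroup}
    {p q : SectionData G S} :
    (p : SectionClass G S) = q ↔ ∃ f : G.Obj → S.S,
      (∀ g, p.arrow g + f (G.r g) = f (G.s g) + q.arrow g) ∧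
      (∀ x, p.real x + f (G.ρ₀ x) = S.conj (f x) + q.real x) ∧
      ∀ x, ContinuousAt (fun y => p.germ x y + f y - q.germ x y) x := by
  rw [eq_comm, QuotientAddGroup.eq]
  refine exists_congr fun f => and_congr (forall_congr' fun g => ?_)
    (and_congr (forall_congr' fun x => ?_) (forall_congr' fun x => ?_))
  · rw [← sub_eq_zero, ← sub_eq_zero (a := p.arrow g + _)]
    exact Eq.congr_left (by simp only [SectionData.arrow, Prod.fst_add, Prod.fst_neg,
      Pi.add_apply, Pi.neg_apply]; abel)
  · rw [← sub_eq_zero, ← sub_eq_zero (a := p.real x + _)]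
    exact Eq.congr_left (by simp only [SectionData.real, Prod.snd_add, Prod.snd_neg, Prod.fst_add,
      Prod.fst_neg, Pi.add_apply, Pi.neg_apply]; abel)
  · refine iff_of_eq (congrArg (ContinuousAt · x) (funext fun y => ?_))
    simp only [SectionData.germ, Prod.snd_add, Prod.snd_neg, Pi.add_apply, Pi.neg_apply]
    abel

namespace TransitionData

variable {G : RealGroupoid.{u}} {S : RealAbGroup} (D : TransitionData G S)

/-- The change of frames at a unit: `e b x` is `change a b x` times `e a x`. -/
def change (a b : D.J) (x : G.Obj) : S.S := D.c a b (G.one x)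

variable {D} {a b d : D.J} {g : G.Arr} {x : G.Obj}

theorem change_add_c (ha : G.r g ∈ D.U a) (hb : G.r g ∈ D.U b) (hd : G.s g ∈ D.U d) :
    D.change a b (G.r g) + D.c b d g = D.c a d g := by
  rw [change, ← D.c_mul a b d _ g (G.s_one _) (by rwa [G.r_one]) (by rwa [G.s_one]) hd,
    G.one_mul]

theorem c_add_change (ha : G.r g ∈ D.U a) (hb : G.s g ∈ D.U b) (hd : G.s g ∈ D.U d) :
    D.c a b g + D.change b d (G.s g) = D.c a d g := by
  rw [change, ← D.c_mul a b d g _ (G.r_one _).symm ha hb (by rwa [G.s_one]), G.mul_one]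

theorem change_add_change (ha : x ∈ D.U a) (hb : x ∈ D.U b) (hd : x ∈ D.U d) :
    D.change a b x + D.change b d x = D.change a d x := by
  have h := change_add_c (g := G.one x) (by rwa [G.r_one]) (by rwa [G.r_one])
    (show G.s (G.one x) ∈ D.U d by rwa [G.s_one]) (a := a) (b := b)
  rwa [G.r_one] at h

theorem change_self (ha : x ∈ D.U a) : D.change a a x = 0 :=
  add_eq_left.1 (change_add_change ha ha ha)

theorem change_ρ (ha : x ∈ D.U a) (hb : x ∈ D.U b) :
    D.change (D.bar a) (D.bar b) (G.ρ₀ x) = S.conj (D.change a b x) := by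
  rw [change, ← G.ρ_one, D.c_ρ a b _ (by rwa [G.r_one]) (by rwa [G.s_one]), change]

theorem continuousAt_change (ha : x ∈ D.U a) (hb : x ∈ D.U b) :
    ContinuousAt (D.change a b) x := by
  have h : ContinuousOn (D.change a b) (D.U a ∩ D.U b) :=
    (D.continuousOn_c a b).comp G.continuous_one.continuousOn fun y hy => by
      simpa [G.r_one, G.s_one] using hy
  exact h.continuousAt (((D.isOpen_U a).inter (D.isOpen_U b)).mem_nhds ⟨ha, hb⟩)

variable (D)

/-- The data of the section `x ↦ e (idx x) x`. -/
def sectionData : SectionData G S :=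
  (fun g => D.c (D.idx (G.r g)) (D.idx (G.s g)) g,
   fun x => D.change (D.idx (G.ρ₀ x)) (D.bar (D.idx x)) (G.ρ₀ x),
   fun x y => D.change (D.idx y) (D.idx x) y)

/-- The class of transition data. -/
def cls : SectionClass G S := D.sectionData

variable {D} in
theorem cls_eq_of_refinement {D' : TransitionData G S} (θ : D'.J → D.J)
    (θ_bar : ∀ j, θ (D'.bar j) = D.bar (θ j)) (subset : ∀ j, D'.U j ⊆ D.U (θ j))
    (hc : ∀ a b g, G.r g ∈ D'.U a → G.s g ∈ D'.U b → D'.c a b g = D.c (θ a) (θ b) g) :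
    D'.cls = D.cls := by
  have hchange : ∀ a b x, x ∈ D'.U a → x ∈ D'.U b →
      D'.change a b x = D.change (θ a) (θ b) x := fun a b x ha hb =>
    hc a b _ (by rwa [G.r_one]) (by rwa [G.s_one])
  have hθ : ∀ x, x ∈ D.U (θ (D'.idx x)) := fun x => subset _ (D'.mem_idx x)
  refine SectionClass.mk_eq_mk_iff.2 ⟨fun x => D.change (D.idx x) (θ (D'.idx x)) x,
    fun g => ?_, fun x => ?_, fun x => ?_⟩
  · change D'.c _ _ g + D.change _ _ (G.r g) = D.change _ _ (G.s g) + D.c _ _ g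
    rw [hc _ _ g (D'.mem_idx _) (D'.mem_idx _), add_comm,
      change_add_c (D.mem_idx _) (hθ _) (hθ _), add_comm,
      c_add_change (D.mem_idx _) (D.mem_idx _) (hθ _)]
  · change D'.change _ _ (G.ρ₀ x) + D.change _ _ (G.ρ₀ x) =
      S.conj (D.change _ _ x) + D.change _ _ (G.ρ₀ x)
    rw [hchange _ _ _ (D'.mem_idx _) (D'.ρ_mem (D'.mem_idx x)), θ_bar, add_comm,
      change_add_change (D.mem_idx _) (hθ _) (D.ρ_mem (hθ x)),
      ← change_ρ (D.mem_idx x) (hθ x), add_comm,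
      change_add_change (D.mem_idx _) (D.ρ_mem (D.mem_idx x)) (D.ρ_mem (hθ x))]
  · refine (continuousAt_change (D.mem_idx x) (hθ x)).congr ?_
    filter_upwards [D'.eventually_mem (D'.mem_idx x), D.eventually_mem (D.mem_idx x)] with y hy hy'
    change _ = D'.change _ _ y + D.change _ _ y - D.change _ _ y
    rw [hchange _ _ _ (D'.mem_idx y) hy, eq_sub_iff_add_eq, add_comm,
      change_add_change (D.mem_idx y) hy' (subset _ hy), add_comm,
      change_add_change (D.mem_idx y) (hθ y) (subset _ hy)]

/-- `β` consists of the coordinates, in the frames, of a nowhere vanishing continuous section that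
is invariant and Real. -/
structure IsTrivialization (β : D.J → G.Obj → S.S) : Prop where
  continuousOn : ∀ a, ContinuousOn (β a) (D.U a)
  bar : ∀ a x, x ∈ D.U a → β (D.bar a) (G.ρ₀ x) = S.conj (β a x)
  c_add : ∀ a b g, G.r g ∈ D.U a → G.s g ∈ D.U b → D.c a b g + β b (G.s g) = β a (G.r g)

variable {D} in
theorem IsTrivialization.change_add {β : D.J → G.Obj → S.S} (hβ : D.IsTrivialization β)
    (ha : x ∈ D.U a) (hb : x ∈ D.U b) : D.change a b x + β b x = β a x := by
  have h := hβ.c_add a b (G.one x) (by rwa [G.r_one]) (by rwa [G.s_one])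
  rwa [G.r_one, G.s_one] at h

variable {D} in
theorem IsTrivialization.cls_eq_zero {β : D.J → G.Obj → S.S} (hβ : D.IsTrivialization β) :
    D.cls = 0 := by
  refine (QuotientAddGroup.eq_zero_iff _).2 ⟨fun x => -β (D.idx x) x,
    fun g => ?_, fun x => ?_, fun x => ?_⟩
  · change D.c _ _ g + -β _ (G.r g) = -β _ (G.s g)
    rw [← hβ.c_add _ _ g (D.mem_idx _) (D.mem_idx _)]
    abel
  · change D.change _ _ (G.ρ₀ x) + -β _ (G.ρ₀ x) = S.conj (-β _ x)
    rw [map_neg, ← hβ.bar _ _ (D.mem_idx x),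
      ← hβ.change_add (D.mem_idx (G.ρ₀ x)) (D.ρ_mem (D.mem_idx x))]
    abel
  · refine (((hβ.continuousOn _).continuousAt (D.eventually_mem (D.mem_idx x))).neg).congr ?_
    filter_upwards [D.eventually_mem (D.mem_idx x)] with y hy
    change _ = D.change _ _ y + _
    rw [← hβ.change_add (D.mem_idx y) hy]
    simp

variable {D} in
theorem exists_isTrivialization (h : D.cls = 0) : ∃ β, D.IsTrivialization β := by
  obtain ⟨f, harrow, hreal, hgerm⟩ := (QuotientAddGroup.eq_zero_iff _).1 h
  refine ⟨fun a x => -(D.change (D.idx x) a x + f x), fun a x hx => ?_, fun a x hx => ?_,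
    fun a b g ha hb => ?_⟩
  · refine ContinuousAt.continuousWithinAt <|
      ((hgerm x).add (continuousAt_change (D.mem_idx x) hx)).neg.congr ?_
    filter_upwards [D.eventually_mem (D.mem_idx x), D.eventually_mem hx] with y hy hy'
    change -(D.change _ _ y + f y + D.change _ _ y) = _
    rw [← change_add_change (D.mem_idx y) hy hy']
    abel
  · rw [map_neg, map_add, ← change_ρ (D.mem_idx x) hx, ← hreal,
      ← change_add_change (D.mem_idx _) (D.ρ_mem (D.mem_idx x)) (D.ρ_mem hx)]
    change _ = -(_ + (D.change _ _ _ + _))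
    abel
  · rw [← harrow]
    change _ + -(_ + (D.c _ _ g + _)) = _
    have hc := (change_add_c (D.mem_idx _) ha hb).trans
      (c_add_change (D.mem_idx _) (D.mem_idx _) hb).symm
    rw [eq_sub_of_add_eq' hc]
    abel

end TransitionData

/-! ### Values of cochains -/

namespace PresimplicialCover

variable {𝒳 : RealSimplicialSpace.{u}} {P : PresimplicialCover 𝒳} {S : RealAbGroup} {n : ℕ}

open Classical in
/-- The value at `x` of the member `c l` of a cochain, with the junk value `0` for `x ∉ U l`. As no
proof of membership enters, indices and points can be rewritten freely. -/
def value (c : P.cochains S n) (l : P.J n) (x : 𝒳.X n) : S.S :=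
  if hx : x ∈ P.U n l then c.1 l ⟨x, hx⟩ else 0

theorem value_of_mem (c : P.cochains S n) {l : P.J n} {x : 𝒳.X n} (hx : x ∈ P.U n l) :
    value c l x = c.1 l ⟨x, hx⟩ :=
  dif_pos hx

theorem ext_value {c c' : P.cochains S n}
    (h : ∀ l, ∀ x ∈ P.U n l, value c l x = value c' l x) : c = c' := by
  ext l x
  rw [← value_of_mem c x.2, ← value_of_mem c' x.2, h l x x.2]

theorem value_add (c c' : P.cochains S n) (l : P.J n) (x : 𝒳.X n) :
    value (c + c') l x = value c l x + value c' l x := by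
  unfold value
  split_ifs
  · rfl
  · exact (add_zero _).symm

theorem value_bar (c : P.cochains S n) {l : P.J n} {x : 𝒳.X n} (hx : x ∈ P.U n l) :
    value c (P.bar n l) (𝒳.ρ n x) = S.conj (value c l x) := by
  rw [value_of_mem c hx, value_of_mem c (P.ρ_mem hx)]
  exact c.2 l x hx

theorem continuousOn_value (c : P.cochains S n) (l : P.J n) :
    ContinuousOn (value c l) (P.U n l) :=
  continuousOn_iff_continuous_domRestrict.2 <|
    (c.1 l).continuous.congr fun x => (value_of_mem c x.2).symm

theorem value_d (c : P.cochains S n) {l : P.J (n + 1)} {x : 𝒳.X (n + 1)}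
    (hx : x ∈ P.U (n + 1) l) :
    value (P.d S n c) l x = ∑ k : Fin (n + 2), (-1 : ℤ) ^ (k : ℕ) •
      value c (P.face (Fin.succAboveOrderEmb k) l)
        (𝒳.map (Fin.succAboveOrderEmb k).toOrderHom x) := by
  rw [value_of_mem _ hx]
  simp only [d, AddMonoidHom.coe_mk, ZeroHom.coe_mk, ContinuousMap.coe_sum,
    ContinuousMap.coe_zsmul, Finset.sum_apply, Pi.smul_apply, ContinuousMap.comp_apply]
  exact Finset.sum_congr rfl fun k _ => congrArg _ (value_of_mem c (P.map_mem _ l x hx)).symm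

theorem value_d_zero (c : P.cochains S 0) {l : P.J 1} {x : 𝒳.X 1} (hx : x ∈ P.U 1 l) :
    value (P.d S 0 c) l x =
      value c (P.face (Fin.succAboveOrderEmb 0) l)
        (𝒳.map (Fin.succAboveOrderEmb 0).toOrderHom x) -
      value c (P.face (Fin.succAboveOrderEmb 1) l)
        (𝒳.map (Fin.succAboveOrderEmb 1).toOrderHom x) := by
  refine (value_d c hx).trans ((Fin.sum_univ_two _).trans ?_)
  simp only [Fin.val_zero, Fin.val_one, pow_zero, pow_one, one_smul, neg_one_smul, sub_eq_add_neg]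

theorem value_d_one (c : P.cochains S 1) {l : P.J 2} {x : 𝒳.X 2} (hx : x ∈ P.U 2 l) :
    value (P.d S 1 c) l x =
      value c (P.face (Fin.succAboveOrderEmb 0) l)
        (𝒳.map (Fin.succAboveOrderEmb 0).toOrderHom x) -
      value c (P.face (Fin.succAboveOrderEmb 1) l)
        (𝒳.map (Fin.succAboveOrderEmb 1).toOrderHom x) +
      value c (P.face (Fin.succAboveOrderEmb 2) l)
        (𝒳.map (Fin.succAboveOrderEmb 2).toOrderHom x) := by
  refine (value_d c hx).trans ((Fin.sum_univ_three _).trans ?_)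
  simp only [Fin.val_zero, Fin.val_one, Fin.val_two, pow_zero, pow_one, neg_one_sq, one_smul,
    neg_one_smul, sub_eq_add_neg]

theorem value_pull {Q : PresimplicialCover 𝒳} (θ : Refinement P.toRealCover Q.toRealCover)
    (c : P.cochains S n) {l : Q.J n} {x : 𝒳.X n} (hx : x ∈ Q.U n l) :
    value (θ.pull S n c) l x = value c (θ.θ n l) x := by
  rw [value_of_mem _ hx, value_of_mem _ (θ.subset n l hx)]
  rfl

section OfFun

variable (F : P.J n → 𝒳.X n → S.S) (hF : ∀ l, ContinuousOn (F l) (P.U n l))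
  (hF_bar : ∀ l, ∀ x ∈ P.U n l, F (P.bar n l) (𝒳.ρ n x) = S.conj (F l x))

/-- The cochain with given values. -/
def ofFun : P.cochains S n :=
  ⟨fun l => ⟨fun x => F l x, (hF l).domRestrict⟩, hF_bar⟩

theorem value_ofFun {l : P.J n} {x : 𝒳.X n} (hx : x ∈ P.U n l) :
    value (ofFun F hF hF_bar) l x = F l x :=
  value_of_mem _ hx

end OfFun

end PresimplicialCover

/-! ### Indices of the associated pre-simplicial cover -/

/-- The increasing map `[0] → [n]` with value `i`. -/
def vertexEmb {n : ℕ} (i : Fin (n + 1)) : Fin 1 ↪o Fin (n + 1) :=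
  OrderEmbedding.ofStrictMono (fun _ => i) (Subsingleton.strictMono _)

theorem eq_vertexEmb {n : ℕ} (φ : Fin 1 ↪o Fin (n + 1)) : φ = vertexEmb (φ 0) := by
  ext i
  rw [Subsingleton.elim i 0]
  rfl

theorem orderEmb_one_one (φ : Fin 1 ↪o Fin 1) : φ = RelEmbedding.refl _ :=
  RelEmbedding.ext fun _ => Subsingleton.elim (α := Fin 1) _ _

theorem orderEmb_two_two (φ : Fin 2 ↪o Fin 2) : φ = RelEmbedding.refl _ := by
  have h : φ 0 < φ 1 := φ.strictMono (by decide)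
  have h' : φ 0 = 0 ∧ φ 1 = 1 := by omega
  exact RelEmbedding.ext (Fin.forall_fin_two.2 h')

theorem orderEmb_two_three (φ : Fin 2 ↪o Fin 3) :
    (φ 0 = 0 ∧ φ 1 = 1) ∨ (φ 0 = 0 ∧ φ 1 = 2) ∨ (φ 0 = 1 ∧ φ 1 = 2) := by
  have h : φ 0 < φ 1 := φ.strictMono (by decide)
  omega

theorem isEmpty_orderEmb_of_lt {k n : ℕ} (h : n < k) : IsEmpty (Fin k ↪o Fin n) :=
  ⟨fun φ => h.not_ge (by simpa using Fintype.card_le_of_injective φ φ.injective)⟩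

namespace RealCover

section Index

variable {𝒳 : RealSimplicialSpace.{u}} {U : RealCover 𝒳}

/-- The index of the associated pre-simplicial cover with values `v` on vertices, `e` on edges and
`t` on simplices of higher dimension. -/
def index {n : ℕ} (v : Fin (n + 1) → U.J 0) (e : (Fin 2 ↪o Fin (n + 1)) → U.J 1)
    (t : ∀ k, (Fin (k + 3) ↪o Fin (n + 1)) → U.J (k + 2)) : U.natural.J n
  | 0, φ => v (φ 0)
  | 1, φ => e φ
  | k + 2, φ => t k φ

/-- The `0`-index with value `a`. -/
def index₀ (a : U.J 0) : U.natural.J 0 :=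
  index (fun _ => a) (fun φ => ((isEmpty_orderEmb_of_lt (by simp)).false φ).elim)
    fun _ φ => ((isEmpty_orderEmb_of_lt (by simp)).false φ).elim

/-- The `1`-index with values `a`, `b` at the vertices and `j` at the edge. -/
def index₁ (a b : U.J 0) (j : U.J 1) : U.natural.J 1 :=
  index ![a, b] (fun _ => j) fun _ φ => ((isEmpty_orderEmb_of_lt (by simp)).false φ).elim

theorem eq_index₀ (l : U.natural.J 0) : l = index₀ (l 0 (RelEmbedding.refl _)) := by
  funext k φ
  match k, φ with
  | 0, φ => exact congrArg (l 0) (orderEmb_one_one φ)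
  | k + 1, φ => exact ((isEmpty_orderEmb_of_lt (by simp)).false φ).elim

theorem eq_index₁ (l : U.natural.J 1) :
    l = index₁ (l 0 (vertexEmb 0)) (l 0 (vertexEmb 1)) (l 1 (RelEmbedding.refl _)) := by
  have h : ∀ i : Fin 2, l 0 (vertexEmb i) = ![l 0 (vertexEmb 0), l 0 (vertexEmb 1)] i :=
    Fin.forall_fin_two.2 ⟨rfl, rfl⟩
  funext k φ
  match k, φ with
  | 0, φ => exact (congrArg (l 0) (eq_vertexEmb φ)).trans (h (φ 0))
  | 1, φ => exact congrArg (l 1) (orderEmb_two_two φ)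
  | k + 2, φ => exact ((isEmpty_orderEmb_of_lt (by simp)).false φ).elim

theorem bar_index₀ (a : U.J 0) : U.natural.bar 0 (index₀ a) = index₀ (U.bar 0 a) :=
  eq_index₀ _

theorem bar_index₁ (a b : U.J 0) (j : U.J 1) :
    U.natural.bar 1 (index₁ a b j) = index₁ (U.bar 0 a) (U.bar 0 b) (U.bar 1 j) :=
  eq_index₁ _

theorem face_zero_index₁ (a b : U.J 0) (j : U.J 1) :
    U.natural.face (Fin.succAboveOrderEmb 0) (index₁ a b j) = index₀ b :=
  eq_index₀ _

theorem face_one_index₁ (a b : U.J 0) (j : U.J 1) :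
    U.natural.face (Fin.succAboveOrderEmb 1) (index₁ a b j) = index₀ a :=
  eq_index₀ _

end Index

section Nerve

variable {G : RealGroupoid.{u}} (U : RealCover G.nerve)

/-- The cover of the unit space given by the cover of the vertices of the nerve. -/
def unitCover : UnitCover G where
  J := U.J 0
  bar := U.bar 0
  bar_bar := U.bar_bar 0
  U a := G.vertex ⁻¹' U.U 0 a
  isOpen_U a := (U.isOpen_U 0 a).preimage G.continuous_vertex
  U_bar a := by
    have hρ : ∀ b x, G.vertex x ∈ U.U 0 b → G.vertex (G.ρ₀ x) ∈ U.U 0 (U.bar 0 b) := by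
      intro b x hx
      have := U.ρ_mem hx
      rwa [← G.vertex_ρ] at this
    ext x
    refine ⟨fun hx => ⟨G.ρ₀ x, ?_, G.ρ₀_ρ₀ x⟩, ?_⟩
    · have := hρ _ x hx
      rwa [U.bar_bar] at this
    · rintro ⟨y, hy, rfl⟩
      exact hρ a y hy
  exists_mem x := U.exists_mem 0 (G.vertex x)

/-- The arrows whose edge in the nerve lies in `U 1 j`. -/
def arrowSet (j : U.J 1) : Set G.Arr := G.edge ⁻¹' U.U 1 j

/-- An index of a member of the cover that contains the edge given by an arrow. -/
def arrowIdx (g : G.Arr) : U.J 1 := (U.exists_mem 1 (G.edge g)).choose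

theorem mem_arrowIdx (g : G.Arr) : g ∈ U.arrowSet (U.arrowIdx g) :=
  (U.exists_mem 1 (G.edge g)).choose_spec

variable {U}

theorem mem_index_iff {n : ℕ} {v : Fin (n + 1) → U.J 0} {e : (Fin 2 ↪o Fin (n + 1)) → U.J 1}
    {t : ∀ k, (Fin (k + 3) ↪o Fin (n + 1)) → U.J (k + 2)} {x : G.NerveObj n} :
    x ∈ U.natural.U n (index v e t) ↔ (∀ i, x.obj i ∈ U.unitCover.U (v i)) ∧
      (∀ φ, x.arr (φ 0) (φ 1) ∈ U.arrowSet (e φ)) ∧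
      ∀ k φ, G.nerve.map φ.toOrderHom x ∈ U.U (k + 2) (t k φ) := by
  have hvertex : ∀ (φ : Fin 1 ↪o Fin (n + 1)) (a : U.J 0),
      G.nerve.map φ.toOrderHom x ∈ U.U 0 a ↔ x.obj (φ 0) ∈ U.unitCover.U a := fun φ a =>
    iff_of_eq (congrArg (· ∈ U.U 0 a) (G.map_eq_vertex φ.toOrderHom x))
  have hedge : ∀ (φ : Fin 2 ↪o Fin (n + 1)) (j : U.J 1),
      G.nerve.map φ.toOrderHom x ∈ U.U 1 j ↔ x.arr (φ 0) (φ 1) ∈ U.arrowSet j := fun φ j =>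
    iff_of_eq (congrArg (· ∈ U.U 1 j) (G.map_eq_edge φ.toOrderHom x))
  constructor
  · exact fun h => ⟨fun i => (hvertex (vertexEmb i) _).1 (h 0 (vertexEmb i)),
      fun φ => (hedge φ _).1 (h 1 φ), fun k φ => h (k + 2) φ⟩
  · rintro ⟨hv, he, ht⟩ k φ
    match k, φ with
    | 0, φ => exact (hvertex φ _).2 (hv _)
    | 1, φ => exact (hedge φ _).2 (he φ)
    | k + 2, φ => exact ht k φ

theorem mem_index₀_iff {a : U.J 0} {x : G.Obj} :
    G.vertex x ∈ U.natural.U 0 (index₀ a) ↔ x ∈ U.unitCover.U a := by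
  refine mem_index_iff.trans ⟨fun h => h.1 0, fun h => ⟨fun _ => h, fun φ => ?_, fun _ φ => ?_⟩⟩
  all_goals exact ((isEmpty_orderEmb_of_lt (by simp)).false φ).elim

theorem mem_index₁_iff {a b : U.J 0} {j : U.J 1} {g : G.Arr} :
    G.edge g ∈ U.natural.U 1 (index₁ a b j) ↔
      G.r g ∈ U.unitCover.U a ∧ G.s g ∈ U.unitCover.U b ∧ g ∈ U.arrowSet j := by
  have hedge : ∀ φ : Fin 2 ↪o Fin 2, (G.edge g).arr (φ 0) (φ 1) = g := fun φ => by
    rw [orderEmb_two_two φ]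
    exact G.edge_arr g
  refine mem_index_iff.trans ?_
  simp only [Nat.reduceAdd, Fin.forall_fin_two, G.edge_obj_zero, G.edge_obj_one, hedge]
  refine ⟨fun ⟨hv, he, _⟩ => ⟨hv.1, hv.2, he (RelEmbedding.refl _)⟩,
    fun ⟨ha, hb, hj⟩ => ⟨⟨ha, hb⟩, fun _ => hj, fun _ φ => ?_⟩⟩
  exact ((isEmpty_orderEmb_of_lt (by simp)).false φ).elim

theorem exists_index₂ {a b d : U.J 0} {i j k : U.J 1} {g h : G.Arr} (e : G.s g = G.r h)
    (ha : G.r g ∈ U.unitCover.U a) (hb : G.s g ∈ U.unitCover.U b) (hd : G.s h ∈ U.unitCover.U d)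
    (hi : g ∈ U.arrowSet i) (hj : h ∈ U.arrowSet j) (hk : G.mul g h e ∈ U.arrowSet k) :
    ∃ l, G.triangle g h e ∈ U.natural.U 2 l ∧
      U.natural.face (Fin.succAboveOrderEmb 0) l = index₁ b d j ∧
      U.natural.face (Fin.succAboveOrderEmb 1) l = index₁ a d k ∧
      U.natural.face (Fin.succAboveOrderEmb 2) l = index₁ a b i := by
  choose t ht using fun n (φ : Fin (n + 3) ↪o Fin 3) =>
    U.exists_mem _ (G.nerve.map φ.toOrderHom (G.triangle g h e))
  refine ⟨index ![a, b, d] (fun φ => if φ 0 = 0 then if φ 1 = 1 then i else k else j) t,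
    mem_index_iff.2 ⟨?_, fun φ => ?_, ht⟩, eq_index₁ _, eq_index₁ _, eq_index₁ _⟩
  · simp [Fin.forall_fin_succ, G.triangle_obj_zero, G.triangle_obj_one, G.triangle_obj_two,
      ha, hb, hd]
  · obtain ⟨h₀, h₁⟩ | ⟨h₀, h₁⟩ | ⟨h₀, h₁⟩ := orderEmb_two_three φ
    · simpa [h₀, h₁, G.triangle_arr_zero_one] using hi
    · simpa [h₀, h₁, G.triangle_arr_zero_two] using hk
    · simpa [h₀, h₁, G.triangle_arr_one_two] using hj

end Nerve

end RealCover

/-! ### The class of a Real `1`-cocycle -/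

namespace RealCover

open PresimplicialCover

variable {G : RealGroupoid.{u}} {S : RealAbGroup} {U : RealCover G.nerve}

section EdgeValue

variable {a b d : U.J 0} {i j k : U.J 1} {g h : G.Arr}

/-- The value of a `1`-cochain at the edge of the nerve given by an arrow. -/
def edgeValue (z : U.natural.cochains S 1) (a b : U.J 0) (j : U.J 1) (g : G.Arr) : S.S :=
  value z (index₁ a b j) (G.edge g)

theorem edgeValue_add_edgeValue (z : U.natural.cocycles S 1) (e : G.s g = G.r h)
    (ha : G.r g ∈ U.unitCover.U a) (hb : G.s g ∈ U.unitCover.U b) (hd : G.s h ∈ U.unitCover.U d)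
    (hi : g ∈ U.arrowSet i) (hj : h ∈ U.arrowSet j) (hk : G.mul g h e ∈ U.arrowSet k) :
    edgeValue z.1 a b i g + edgeValue z.1 b d j h = edgeValue z.1 a d k (G.mul g h e) := by
  obtain ⟨l, hl, hl₀, hl₁, hl₂⟩ := exists_index₂ e ha hb hd hi hj hk
  have hd : value (U.natural.d S 1 z.1) l (G.triangle g h e) = 0 := by
    rw [show U.natural.d S 1 z.1 = 0 from z.2, value_of_mem _ hl]
    rfl
  rw [value_d_one z.1 hl, hl₀, hl₁, hl₂,
    (G.map_eq_edge _ _).trans (congrArg G.edge (G.triangle_arr_one_two g h e)),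
    (G.map_eq_edge _ _).trans (congrArg G.edge (G.triangle_arr_zero_two g h e)),
    (G.map_eq_edge _ _).trans (congrArg G.edge (G.triangle_arr_zero_one g h e)),
    sub_add_eq_add_sub, sub_eq_zero, add_comm] at hd
  exact hd

theorem edgeValue_eq (z : U.natural.cocycles S 1) (ha : G.r g ∈ U.unitCover.U a)
    (hb : G.s g ∈ U.unitCover.U b) (hi : g ∈ U.arrowSet i) (hj : g ∈ U.arrowSet j) :
    edgeValue z.1 a b i g = edgeValue z.1 a b j g := by
  have h := fun k (hk : g ∈ U.arrowSet k) =>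
    edgeValue_add_edgeValue z (G.r_one (G.s g)).symm ha hb (by rwa [G.s_one]) hk
      (U.mem_arrowIdx _) (by rwa [G.mul_one]) (k := i)
  exact add_right_cancel ((h i hi).trans (h j hj).symm)

theorem edge_ρ_mem (h : G.edge g ∈ U.natural.U 1 (index₁ a b j)) :
    G.edge (G.ρ g) ∈ U.natural.U 1 (index₁ (U.bar 0 a) (U.bar 0 b) (U.bar 1 j)) := by
  rw [← bar_index₁, G.edge_ρ]
  exact U.natural.ρ_mem h

theorem edgeValue_ρ (z : U.natural.cochains S 1) (h : G.edge g ∈ U.natural.U 1 (index₁ a b j)) :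
    edgeValue z (U.bar 0 a) (U.bar 0 b) (U.bar 1 j) (G.ρ g) = S.conj (edgeValue z a b j g) := by
  rw [edgeValue, ← bar_index₁, G.edge_ρ, value_bar z h, edgeValue]

theorem continuousAt_edgeValue (z : U.natural.cochains S 1)
    (h : G.edge g ∈ U.natural.U 1 (index₁ a b j)) : ContinuousAt (edgeValue z a b j) g :=
  ((continuousOn_value z _).continuousAt ((U.natural.isOpen_U 1 _).mem_nhds h)).comp
    G.continuous_edge.continuousAt

theorem value_vertex_ρ (β : U.natural.cochains S 0) {x : G.Obj} (hx : x ∈ U.unitCover.U a) :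
    value β (index₀ (U.bar 0 a)) (G.vertex (G.ρ₀ x)) =
      S.conj (value β (index₀ a) (G.vertex x)) := by
  rw [← bar_index₀, G.vertex_ρ, value_bar β (mem_index₀_iff.2 hx)]

theorem edgeValue_d (β : U.natural.cochains S 0)
    (h : G.edge g ∈ U.natural.U 1 (index₁ a b j)) :
    edgeValue (U.natural.d S 0 β) a b j g =
      value β (index₀ b) (G.vertex (G.s g)) - value β (index₀ a) (G.vertex (G.r g)) := by
  refine (value_d_zero β h).trans ?_
  rw [face_zero_index₁, face_one_index₁,
    (G.map_eq_vertex _ _).trans (congrArg G.vertex (G.edge_obj_one g)),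
    (G.map_eq_vertex _ _).trans (congrArg G.vertex (G.edge_obj_zero g))]

end EdgeValue

/-- The transition data given by the values of a cocycle. -/
def transitionData (z : U.natural.cocycles S 1) : TransitionData G S where
  toUnitCover := U.unitCover
  c a b g := edgeValue z.1 a b (U.arrowIdx g) g
  c_mul a b d g h e ha hb hd := (edgeValue_add_edgeValue z e ha hb hd (U.mem_arrowIdx g)
    (U.mem_arrowIdx h) (U.mem_arrowIdx _)).symm
  c_ρ a b g ha hb :=
    have hmem := mem_index₁_iff.2 ⟨ha, hb, U.mem_arrowIdx g⟩
    have ⟨ha', hb', hj⟩ := mem_index₁_iff.1 (edge_ρ_mem hmem)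
    (edgeValue_eq z ha' hb' (U.mem_arrowIdx _) hj).trans (edgeValue_ρ z.1 hmem)
  continuousOn_c a b g hg := by
    have hmem : ∀ᶠ g' in 𝓝[{g | G.r g ∈ U.unitCover.U a ∧ G.s g ∈ U.unitCover.U b}] g,
        g' ∈ U.arrowSet (U.arrowIdx g) := mem_nhdsWithin_of_mem_nhds <|
      ((U.isOpen_U 1 _).preimage G.continuous_edge).mem_nhds (U.mem_arrowIdx g)
    refine ContinuousWithinAt.congr_of_eventuallyEq (f := edgeValue z.1 a b (U.arrowIdx g))
      (continuousAt_edgeValue z.1 ?_).continuousWithinAt ?_ rfl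
    · exact mem_index₁_iff.2 ⟨hg.1, hg.2, U.mem_arrowIdx g⟩
    · filter_upwards [hmem, self_mem_nhdsWithin] with g' hg' hU
      exact edgeValue_eq z hU.1 hU.2 (U.mem_arrowIdx g') hg'

theorem cls_transitionData_add (z z' : U.natural.cocycles S 1) :
    (transitionData (z + z')).cls = (transitionData z).cls + (transitionData z').cls := by
  have hc : ∀ a b g, (transitionData (z + z')).c a b g =
      (transitionData z).c a b g + (transitionData z').c a b g := fun _ _ _ => value_add _ _ _ _
  refine congrArg _ (Prod.ext ?_ (Prod.ext ?_ ?_))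
  · exact funext fun g => hc _ _ g
  · exact funext fun x => hc _ _ _
  · exact funext fun x => funext fun y => hc _ _ _

theorem exists_d_eq_of_isTrivialization {z : U.natural.cocycles S 1}
    {β : U.J 0 → G.Obj → S.S} (hβ : (transitionData z).IsTrivialization β) :
    ∃ c, U.natural.d S 0 c = z.1 := by
  have hmem : ∀ (l : U.natural.J 0) (x : G.NerveObj 0), x ∈ U.natural.U 0 l →
      x.obj 0 ∈ U.unitCover.U (l 0 (RelEmbedding.refl _)) := by
    intro l x hx
    rwa [eq_index₀ l, G.eq_vertex x, mem_index₀_iff] at hx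
  let c : U.natural.cochains S 0 :=
    ofFun (fun l (x : G.NerveObj 0) => -β (l 0 (RelEmbedding.refl _)) (x.obj 0))
      (fun l => ((hβ.continuousOn _).comp
        (RealGroupoid.NerveObj.continuous_obj G 0).continuousOn (hmem l)).neg)
      (fun l x hx => (congrArg _ (hβ.bar _ _ (hmem l x hx))).trans (map_neg _ _).symm)
  have hc : ∀ a x, x ∈ U.unitCover.U a → value c (index₀ a) (G.vertex x) = -β a x :=
    fun a x hx => value_ofFun _ _ _ (mem_index₀_iff.2 hx)
  refine ⟨c, ext_value fun l (x : G.NerveObj 1) hx => ?_⟩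
  generalize l 0 (vertexEmb 0) = a, l 0 (vertexEmb 1) = b, l 1 (RelEmbedding.refl _) = j,
    x.arr 0 1 = g, eq_index₁ l = hl, G.eq_edge x = hg
  subst hl hg
  obtain ⟨ha, hb, hj⟩ := mem_index₁_iff.1 hx
  refine (edgeValue_d c hx).trans (Eq.trans ?_ (edgeValue_eq z ha hb (U.mem_arrowIdx g) hj))
  rw [hc a _ ha, hc b _ hb, sub_neg_eq_add, neg_add_eq_sub, sub_eq_iff_eq_add]
  exact (hβ.c_add a b g ha hb).symm

theorem isTrivialization_of_d_eq {z : U.natural.cocycles S 1} {c : U.natural.cochains S 0}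
    (hc : U.natural.d S 0 c = z.1) : (transitionData z).IsTrivialization
      fun (a : U.J 0) x => -value c (index₀ a) (G.vertex x) where
  continuousOn a := ((continuousOn_value c _).comp G.continuous_vertex.continuousOn
    fun x hx => mem_index₀_iff.2 hx).neg
  bar a x hx := (congrArg Neg.neg (value_vertex_ρ c hx)).trans (map_neg _ _).symm
  c_add a b g ha hb := by
    change edgeValue z.1 a b _ g + _ = _
    rw [← hc, edgeValue_d c (mem_index₁_iff.2 ⟨ha, hb, U.mem_arrowIdx g⟩)]
    abel

theorem cls_transitionData_eq_zero_iff (z : U.natural.cocycles S 1) :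
    (transitionData z).cls = 0 ↔ z.1 ∈ U.natural.coboundaries S 1 :=
  ⟨fun hz => have ⟨_, hβ⟩ := TransitionData.exists_isTrivialization hz
    exists_d_eq_of_isTrivialization hβ,
    fun ⟨_, hc⟩ => (isTrivialization_of_d_eq hc).cls_eq_zero⟩

variable (U S) in
/-- The section class of a `1`-cohomology class of a Real open cover. -/
def clsHom : U.HR S 1 →+ SectionClass G S :=
  QuotientAddGroup.lift _
    (AddMonoidHom.mk' (fun z => (transitionData z).cls) cls_transitionData_add)
    fun z hz => (cls_transitionData_eq_zero_iff z).2 hz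

theorem clsHom_injective : Function.Injective (clsHom S U) :=
  (injective_iff_map_eq_zero _).2 fun y hy => by
    obtain ⟨z, rfl⟩ := QuotientAddGroup.mk_surjective y
    exact (QuotientAddGroup.eq_zero_iff z).2 ((cls_transitionData_eq_zero_iff z).1 hy)

theorem clsHom_cohomologyMap {V : RealCover G.nerve} (θ : Refinement U V) (y : U.HR S 1) :
    clsHom S V (θ.natural.cohomologyMap S θ.natural_isPresimplicial 1 y) = clsHom S U y := by
  obtain ⟨z, rfl⟩ := QuotientAddGroup.mk_surjective y
  refine TransitionData.cls_eq_of_refinement (D := transitionData z) (θ.θ 0) (θ.θ_bar 0)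
    (fun j x hx => θ.subset 0 j hx) fun a b g ha hb => ?_
  have hmem := mem_index₁_iff.2 ⟨ha, hb, V.mem_arrowIdx g⟩
  have hθ : θ.natural.θ 1 (index₁ a b (V.arrowIdx g)) =
    index₁ (θ.θ 0 a) (θ.θ 0 b) (θ.θ 1 (V.arrowIdx g)) := eq_index₁ _
  have hθmem := θ.natural.subset 1 _ hmem
  rw [hθ] at hθmem
  obtain ⟨ha', hb', hj⟩ := mem_index₁_iff.1 hθmem
  refine (value_pull θ.natural z.1 hmem).trans ?_
  rw [hθ]
  exact edgeValue_eq z ha' hb' hj (U.mem_arrowIdx g)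

end RealCover

/-! ### The inductive limit -/

namespace RealCover

variable {𝒳 : RealSimplicialSpace.{u}}

/-- The cover by the whole spaces. -/
def univ (𝒳 : RealSimplicialSpace.{u}) : RealCover 𝒳 where
  J _ := PUnit
  bar _ := id
  bar_bar _ _ := rfl
  U _ _ := Set.univ
  isOpen_U _ _ := isOpen_univ
  U_bar n _ := (Set.image_univ_of_surjective (Function.Involutive.surjective (𝒳.ρ_ρ n))).symm
  exists_mem _ _ := ⟨⟨⟩, Set.mem_univ _⟩

theorem admitsSimplicial_univ (N : ℕ) : (univ 𝒳).AdmitsSimplicial N :=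
  ⟨fun _ _ _ _ _ => id, fun _ _ _ => rfl, fun _ _ _ _ _ _ _ _ _ => rfl, fun _ _ _ _ _ _ => rfl,
    fun _ _ _ _ _ _ _ _ => Set.mem_univ _⟩

theorem AdmitsSimplicial.mono {U : RealCover 𝒳} {N N' : ℕ} (h : U.AdmitsSimplicial N)
    (hN : N' ≤ N) : U.AdmitsSimplicial N' := by
  obtain ⟨F, h₁, h₂, h₃, h₄⟩ := h
  exact ⟨fun m n hm hn => F m n (hm.trans hN) (hn.trans hN), fun n hn => h₁ n _,
    fun l m n hl hm hn => h₂ l m n _ _ _, fun m n hm hn => h₃ m n _ _, fun m n hm hn => h₄ m n _ _⟩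

/-- The cover by the intersections of the members of two covers. -/
def inter (U V : RealCover 𝒳) : RealCover 𝒳 where
  J n := U.J n × V.J n
  bar n j := (U.bar n j.1, V.bar n j.2)
  bar_bar n j := Prod.ext (U.bar_bar n _) (V.bar_bar n _)
  U n j := U.U n j.1 ∩ V.U n j.2
  isOpen_U n j := (U.isOpen_U n _).inter (V.isOpen_U n _)
  U_bar n j := by
    rw [U.U_bar, V.U_bar, Set.image_inter (Function.LeftInverse.injective (𝒳.ρ_ρ n))]
  exists_mem n x := by
    obtain ⟨i, hi⟩ := U.exists_mem n x
    obtain ⟨j, hj⟩ := V.exists_mem n x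
    exact ⟨(i, j), hi, hj⟩

theorem AdmitsSimplicial.inter {U V : RealCover 𝒳} {N : ℕ} (h : U.AdmitsSimplicial N)
    (h' : V.AdmitsSimplicial N) : (U.inter V).AdmitsSimplicial N := by
  obtain ⟨F, h₁, h₂, h₃, h₄⟩ := h
  obtain ⟨F', h₁', h₂', h₃', h₄'⟩ := h'
  exact ⟨fun m n hm hn f j => (F m n hm hn f j.1, F' m n hm hn f j.2),
    fun n hn j => Prod.ext (h₁ n hn _) (h₁' n hn _),
    fun l m n hl hm hn f g j => Prod.ext (h₂ l m n hl hm hn f g _) (h₂' l m n hl hm hn f g _),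
    fun m n hm hn f j => Prod.ext (h₃ m n hm hn f _) (h₃' m n hm hn f _),
    fun m n hm hn f j x hx => ⟨h₄ m n hm hn f _ x hx.1, h₄' m n hm hn f _ x hx.2⟩⟩

end RealCover

theorem AdmissibleCover.exists_common_refinement {𝒳 : RealSimplicialSpace.{u}} {n : ℕ}
    (U V : AdmissibleCover 𝒳 n) :
    ∃ W : AdmissibleCover 𝒳 n, Nonempty (Refinement U.1 W.1) ∧ Nonempty (Refinement V.1 W.1) := by
  obtain ⟨U, N, hN, hU⟩ := U
  obtain ⟨V, N', hN', hV⟩ := V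
  exact ⟨⟨U.inter V, min N N', le_min hN hN',
      (hU.mono (min_le_left _ _)).inter (hV.mono (min_le_right _ _))⟩,
    ⟨fun _ => Prod.fst, fun _ _ => rfl, fun _ _ => Set.inter_subset_left⟩,
    ⟨fun _ => Prod.snd, fun _ _ => rfl, fun _ _ => Set.inter_subset_right⟩⟩

namespace CechHR

variable {𝒳 : RealSimplicialSpace.{u}} {S : RealAbGroup} {n : ℕ}

open Classical in
/-- The canonical map from the cohomology of a cover to the inductive limit. -/
def of (U : AdmissibleCover 𝒳 n) : U.1.HR S n →+ CechHR 𝒳 S n :=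
  (QuotientAddGroup.mk' _).comp (DirectSum.of (fun U : AdmissibleCover 𝒳 n => U.1.HR S n) U)

theorem of_cohomologyMap {U V : AdmissibleCover 𝒳 n} (θ : Refinement U.1 V.1)
    (y : U.1.HR S n) :
    of V (θ.natural.cohomologyMap S θ.natural_isPresimplicial n y) = of U y :=
  ((QuotientAddGroup.eq_iff_sub_mem (N := cechRelations 𝒳 S n)).2
    (AddSubgroup.subset_closure ⟨U, V, θ, y, rfl⟩)).symm

theorem exists_of_eq (q : CechHR 𝒳 S n) :
    ∃ (U : AdmissibleCover 𝒳 n) (y : U.1.HR S n), of U y = q := by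
  classical
  obtain ⟨w, rfl⟩ := QuotientAddGroup.mk_surjective q
  induction w using DirectSum.induction_on with
  | zero =>
    exact ⟨⟨.univ 𝒳, n + 1, le_rfl, RealCover.admitsSimplicial_univ _⟩, 0, map_zero _⟩
  | of U y => exact ⟨U, y, by rw [of]; congr⟩
  | add w w' h h' =>
    obtain ⟨U, y, hy⟩ := h
    obtain ⟨V, y', hy'⟩ := h'
    obtain ⟨W, ⟨θ⟩, ⟨η⟩⟩ := U.exists_common_refinement V
    refine ⟨W, θ.natural.cohomologyMap S θ.natural_isPresimplicial n y +
      η.natural.cohomologyMap S η.natural_isPresimplicial n y', ?_⟩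
    rw [map_add, of_cohomologyMap, of_cohomologyMap, hy, hy', QuotientAddGroup.mk_add]

variable {G : RealGroupoid.{u}}

variable (S G) in
open Classical in
/-- The section class of a Čech cohomology class. -/
def cls : CechHR G.nerve S 1 →+ SectionClass G S :=
  QuotientAddGroup.lift _ (DirectSum.toAddMonoid fun U => U.1.clsHom S) <| by
    refine (AddSubgroup.closure_le _).2 ?_
    rintro _ ⟨U, V, θ, y, rfl⟩
    refine AddMonoidHom.mem_ker.2 ?_
    rw [map_sub, DirectSum.toAddMonoid_of, DirectSum.toAddMonoid_of,
      RealCover.clsHom_cohomologyMap, sub_self]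

theorem cls_of (U : AdmissibleCover G.nerve 1) (y : U.1.HR S 1) :
    cls S G (of U y) = U.1.clsHom S y := by
  classical
  exact DirectSum.toAddMonoid_of _ _ _

theorem cls_injective : Function.Injective (cls S G) := by
  refine (injective_iff_map_eq_zero _).2 fun q hq => ?_
  obtain ⟨U, y, rfl⟩ := exists_of_eq q
  rw [cls_of] at hq
  rw [(injective_iff_map_eq_zero _).1 RealCover.clsHom_injective y hq, map_zero]

theorem exists_cls_transitionData_eq (q : CechHR G.nerve S 1) :
    ∃ D : TransitionData G S, D.cls = cls S G q := by
  obtain ⟨U, y, rfl⟩ := exists_of_eq q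
  obtain ⟨z, rfl⟩ := QuotientAddGroup.mk_surjective y
  exact ⟨RealCover.transitionData z, (cls_of U (QuotientAddGroup.mk z)).symm⟩

end CechHR

/-! ### The Čech cohomology class of transition data -/

/-- The cover of the nerve induced by a cover of the unit space: a simplex lies in a member if its
vertices lie in the corresponding sets. -/
def UnitCover.cover {G : RealGroupoid.{u}} (𝒰 : UnitCover G) : RealCover G.nerve where
  J n := Fin (n + 1) → 𝒰.J
  bar _ l i := 𝒰.bar (l i)
  bar_bar _ l := funext fun i => 𝒰.bar_bar (l i)
  U n l := ⋂ i, (fun x : G.NerveObj n => x.obj i) ⁻¹' 𝒰.U (l i)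
  isOpen_U n l := isOpen_iInter_of_finite fun i =>
    (𝒰.isOpen_U _).preimage (RealGroupoid.NerveObj.continuous_obj G i)
  U_bar n l := by
    ext x
    simp only [Set.mem_iInter, Set.mem_image]
    refine ⟨fun hx => ⟨G.nerve.ρ n x, fun i => ?_, G.nerve.ρ_ρ n x⟩, ?_⟩
    · have := 𝒰.ρ_mem (hx i)
      rwa [𝒰.bar_bar] at this
    · rintro ⟨y, hy, rfl⟩ i
      exact 𝒰.ρ_mem (hy i)
  exists_mem n (x : G.NerveObj n) :=
    ⟨fun i => 𝒰.idx (x.obj i), Set.mem_iInter.2 fun i => 𝒰.mem_idx (x.obj i)⟩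

theorem UnitCover.admitsSimplicial_cover {G : RealGroupoid.{u}} (𝒰 : UnitCover G) (N : ℕ) :
    𝒰.cover.AdmitsSimplicial N :=
  ⟨fun _ _ _ _ f l i => l (f i), fun _ _ _ => rfl, fun _ _ _ _ _ _ _ _ _ => rfl,
    fun _ _ _ _ _ _ => rfl, fun _ _ _ _ f _ _ hx =>
      Set.mem_iInter.2 fun i => Set.mem_iInter.1 hx (f i)⟩

namespace TransitionData

open PresimplicialCover RealCover

variable {G : RealGroupoid.{u}} {S : RealAbGroup} (D : TransitionData G S) {n : ℕ}

/-- The index of the member of the cover that an index of the associated pre-simplicial cover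
assigns to the `i`-th vertex. -/
def vertexIdx (l : D.cover.natural.J n) (i : Fin (n + 1)) : D.J := l 0 (vertexEmb i) 0

variable {D}

theorem vertexIdx_face {m : ℕ} (l : D.cover.natural.J n) (f : Fin (m + 1) ↪o Fin (n + 1))
    (i : Fin (m + 1)) : D.vertexIdx (D.cover.natural.face f l) i = D.vertexIdx l (f i) :=
  congrFun (congrArg (l 0) (eq_vertexEmb _)) 0

variable {l : D.cover.natural.J n} {x : G.NerveObj n} (hx : x ∈ D.cover.natural.U n l)
  (i j : Fin (n + 1))

include hx

theorem obj_mem : x.obj i ∈ D.U (D.vertexIdx l i) :=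
  Set.mem_iInter.1 (hx 0 (vertexEmb i)) 0

theorem r_arr_mem : G.r (x.arr i j) ∈ D.U (D.vertexIdx l i) := by
  rw [x.r_arr]; exact obj_mem hx i

theorem s_arr_mem : G.s (x.arr i j) ∈ D.U (D.vertexIdx l j) := by
  rw [x.s_arr]; exact obj_mem hx j

omit hx

variable (D)

/-- The `1`-cochain of transition data, on the cover induced by the one of the unit space. -/
def cochain : D.cover.natural.cochains S 1 :=
  ofFun (fun l (x : G.NerveObj 1) => D.c (D.vertexIdx l 0) (D.vertexIdx l 1) (x.arr 0 1))
    (fun _ => (D.continuousOn_c _ _).comp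
      (RealGroupoid.NerveObj.continuous_arr G 0 1).continuousOn
      fun _ hx => ⟨r_arr_mem hx 0 1, s_arr_mem hx 0 1⟩)
    fun _ _ hx => D.c_ρ _ _ _ (r_arr_mem hx 0 1) (s_arr_mem hx 0 1)

theorem value_cochain {l : D.cover.natural.J 1} {x : G.NerveObj 1}
    (hx : x ∈ D.cover.natural.U 1 l) :
    value D.cochain l x = D.c (D.vertexIdx l 0) (D.vertexIdx l 1) (x.arr 0 1) :=
  value_ofFun _ _ _ hx

theorem value_face_cochain (f : Fin 2 ↪o Fin (n + 1)) {l : D.cover.natural.J n}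
    {x : G.NerveObj n} (hx : x ∈ D.cover.natural.U n l) :
    value D.cochain (D.cover.natural.face f l) (G.nerve.map f.toOrderHom x) =
      D.c (D.vertexIdx l (f 0)) (D.vertexIdx l (f 1)) (x.arr (f 0) (f 1)) := by
  refine (D.value_cochain (D.cover.natural.map_mem f l x hx)).trans ?_
  rw [vertexIdx_face, vertexIdx_face]
  rfl

theorem cochain_mem_cocycles : D.cochain ∈ D.cover.natural.cocycles S 1 := by
  refine ext_value fun l (x : G.NerveObj 2) hx => ?_
  have h := D.c_mul _ _ _ (x.arr 0 1) (x.arr 1 2) (by rw [x.s_arr, x.r_arr])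
    (r_arr_mem hx 0 1) (s_arr_mem hx 0 1) (s_arr_mem hx 1 2)
  rw [x.arr_mul] at h
  rw [value_d_one _ hx, D.value_face_cochain _ hx, D.value_face_cochain _ hx,
    D.value_face_cochain _ hx, value_of_mem _ hx]
  change D.c (D.vertexIdx l 1) (D.vertexIdx l 2) (x.arr 1 2) -
    D.c (D.vertexIdx l 0) (D.vertexIdx l 2) (x.arr 0 2) +
    D.c (D.vertexIdx l 0) (D.vertexIdx l 1) (x.arr 0 1) = 0
  rw [h]
  abel

theorem exists_cechCls_eq : ∃ q, CechHR.cls S G q = D.cls := by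
  refine ⟨CechHR.of ⟨D.cover, 2, le_rfl, D.admitsSimplicial_cover 2⟩
    (QuotientAddGroup.mk ⟨D.cochain, D.cochain_mem_cocycles⟩), (CechHR.cls_of _ _).trans ?_⟩
  refine cls_eq_of_refinement (fun a => a 0) (fun _ => rfl)
    (fun a x hx => Set.mem_iInter.1 hx 0) fun a b g ha hb => ?_
  exact (D.value_cochain (mem_index₁_iff.2 ⟨ha, hb, D.cover.mem_arrowIdx g⟩)).trans
    (congrArg (D.c (a 0) (b 0)) (G.edge_arr g))

end TransitionData

/-! ### Unit complex numbers -/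

/-- The inclusion of the circle group, written additively, into the complex numbers. -/
def circleVal (a : RealAbGroup.circle.S) : ℂ := (Additive.toMul (α := Circle) a : ℂ)

theorem circleVal_injective : Function.Injective circleVal :=
  Circle.coe_injective.comp Additive.toMul.injective

theorem isInducing_circleVal : IsInducing circleVal := IsInducing.subtypeVal

theorem continuous_circleVal : Continuous circleVal := isInducing_circleVal.continuous

@[simp] theorem norm_circleVal (a : RealAbGroup.circle.S) : ‖circleVal a‖ = 1 := Circle.norm_coe _

theorem circleVal_ne_zero (a : RealAbGroup.circle.S) : circleVal a ≠ 0 := Circle.coe_ne_zero _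

theorem circleVal_zero : circleVal 0 = 1 := rfl

theorem circleVal_add (a b : RealAbGroup.circle.S) :
    circleVal (a + b) = circleVal a * circleVal b := rfl

theorem circleVal_neg (a : RealAbGroup.circle.S) : circleVal (-a) = (circleVal a)⁻¹ :=
  Circle.coe_inv _

theorem circleVal_conj (a : RealAbGroup.circle.S) :
    circleVal (RealAbGroup.circle.conj a) = starRingEnd ℂ (circleVal a) := rfl

/-- The phase of a complex number. -/
def phase (z : ℂ) : RealAbGroup.circle.S := Additive.ofMul (Circle.exp z.arg)

theorem circleVal_phase {z : ℂ} (hz : z ≠ 0) : circleVal (phase z) = z / ‖z‖ := by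
  rw [eq_div_iff (by simpa using hz), mul_comm]
  exact Complex.norm_mul_exp_arg_mul_I z

theorem circleVal_phase_of_norm_eq_one {z : ℂ} (hz : ‖z‖ = 1) : circleVal (phase z) = z := by
  rw [circleVal_phase (norm_ne_zero_iff.1 (hz ▸ one_ne_zero)), hz, Complex.ofReal_one, div_one]

theorem phase_circleVal (a : RealAbGroup.circle.S) : phase (circleVal a) = a :=
  circleVal_injective (circleVal_phase_of_norm_eq_one (norm_circleVal a))

theorem phase_mul {z w : ℂ} (hz : z ≠ 0) (hw : w ≠ 0) : phase (z * w) = phase z + phase w := by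
  apply circleVal_injective
  rw [circleVal_add, circleVal_phase hz, circleVal_phase hw, circleVal_phase (mul_ne_zero hz hw),
    norm_mul, Complex.ofReal_mul, mul_div_mul_comm]

theorem phase_conj {z : ℂ} (hz : z ≠ 0) :
    phase (starRingEnd ℂ z) = RealAbGroup.circle.conj (phase z) := by
  apply circleVal_injective
  rw [circleVal_conj, circleVal_phase hz, circleVal_phase (by simpa using hz), map_div₀,
    Complex.conj_ofReal, RCLike.norm_conj]

theorem continuousAt_phase {z : ℂ} (hz : z ≠ 0) : ContinuousAt phase z := by
  refine isInducing_circleVal.continuousAt_iff.2 <| ContinuousAt.congr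
    (f := fun w : ℂ => w / ‖w‖) (by fun_prop (disch := simpa using hz)) ?_
  filter_upwards [isOpen_ne.mem_nhds hz] with w hw
  exact (circleVal_phase hw).symm

/-! ### Coordinates on the fibres of line bundles -/

section fiberCoord

variable {B : Type*} [TopologicalSpace B] {E : B → Type*} [∀ x, AddCommGroup (E x)]
  [∀ x, Module ℂ (E x)] [∀ x, TopologicalSpace (E x)] [TopologicalSpace (TotalSpace ℂ E)]
  [FiberBundle ℂ E] [VectorBundle ℂ ℂ E]

/-- The linear form `v ↦ v / w` on a fibre. -/
def fiberCoord {x : B} (w : E x) : E x →ₗ[ℂ] ℂ :=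
  (VectorBundle.continuousLinearEquivAt ℂ ℂ E x w)⁻¹ •
    (VectorBundle.continuousLinearEquivAt ℂ ℂ E x).toLinearEquiv.toLinearMap

theorem fiberCoord_smul_self {x : B} {w : E x} (hw : w ≠ 0) (v : E x) :
    fiberCoord w v • w = v := by
  apply (VectorBundle.continuousLinearEquivAt ℂ ℂ E x).injective
  rw [map_smul]
  exact (mul_right_comm _ _ _).trans <| (congrArg (· * _) (inv_mul_cancel₀
    ((map_ne_zero_iff _ (ContinuousLinearEquiv.injective _)).2 hw))).trans (one_mul _)

theorem fiberCoord_apply_smul {x : B} {w : E x} (hw : w ≠ 0) (z : ℂ) :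
    fiberCoord w (z • w) = z :=
  smul_left_injective ℂ hw (fiberCoord_smul_self hw _)

theorem fiberCoord_self {x : B} {w : E x} (hw : w ≠ 0) : fiberCoord w w = 1 := by
  rw [← fiberCoord_apply_smul hw 1, one_smul]

variable (E) in
theorem finrank_fiber (x : B) : Module.finrank ℂ (E x) = 1 :=
  (VectorBundle.continuousLinearEquivAt ℂ ℂ E x).toLinearEquiv.finrank_eq.trans
    (Module.finrank_self ℂ)

theorem exists_eq_smul {x : B} {w : E x} (hw : w ≠ 0) (v : E x) : ∃ z : ℂ, v = z • w :=
  ⟨_, (fiberCoord_smul_self hw v).symm⟩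

variable {Y : Type*} [TopologicalSpace Y] {f : Y → B} {v w : ∀ y, E (f y)} {y₀ : Y}

theorem continuousAt_smul_mk {u : Y → ℂ} (hu : ContinuousAt u y₀)
    (hv : ContinuousAt (fun y => (⟨f y, v y⟩ : TotalSpace ℂ E)) y₀) :
    ContinuousAt (fun y => (⟨f y, u y • v y⟩ : TotalSpace ℂ E)) y₀ := by
  obtain ⟨hf, hv⟩ := (FiberBundle.continuousAt_totalSpace ℂ _).1 hv
  refine (FiberBundle.continuousAt_totalSpace ℂ _).2 ⟨hf, (hu.mul hv).congr ?_⟩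
  filter_upwards [hf.preimage_mem_nhds ((trivializationAt ℂ E (f y₀)).open_baseSet.mem_nhds
    (FiberBundle.mem_baseSet_trivializationAt' (f y₀)))] with y hy
  exact (((trivializationAt ℂ E (f y₀)).linear ℂ hy).map_smul (u y) (v y)).symm

theorem fiberCoord_eq_div (e : Trivialization ℂ (TotalSpace.proj : TotalSpace ℂ E → B))
    [e.IsLinear ℂ] {x : B} (hx : x ∈ e.baseSet) {w : E x} (hw : w ≠ 0) (v : E x) :
    fiberCoord w v = (e ⟨x, v⟩).2 / (e ⟨x, w⟩).2 := by
  have he : (e ⟨x, w⟩).2 ≠ 0 :=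
    (map_ne_zero_iff (e.linearEquivAt ℂ x hx) (LinearEquiv.injective _)).2 hw
  obtain ⟨z, rfl⟩ := exists_eq_smul hw v
  rw [fiberCoord_apply_smul hw, eq_div_iff he]
  exact ((e.linear ℂ hx).map_smul z w).symm

theorem continuousAt_fiberCoord (hw₀ : ∀ᶠ y in 𝓝 y₀, w y ≠ 0)
    (hw : ContinuousAt (fun y => (⟨f y, w y⟩ : TotalSpace ℂ E)) y₀)
    (hv : ContinuousAt (fun y => (⟨f y, v y⟩ : TotalSpace ℂ E)) y₀) :
    ContinuousAt (fun y => fiberCoord (w y) (v y)) y₀ := by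
  obtain ⟨hf, hv⟩ := (FiberBundle.continuousAt_totalSpace ℂ _).1 hv
  obtain ⟨-, hw⟩ := (FiberBundle.continuousAt_totalSpace ℂ _).1 hw
  have hmem := FiberBundle.mem_baseSet_trivializationAt' (F := ℂ) (E := E) (f y₀)
  refine (hv.div hw ?_).congr ?_
  · exact (map_ne_zero_iff ((trivializationAt ℂ E (f y₀)).linearEquivAt ℂ _ hmem)
      (LinearEquiv.injective _)).2 hw₀.self_of_nhds
  · filter_upwards [hf.preimage_mem_nhds
      ((trivializationAt ℂ E (f y₀)).open_baseSet.mem_nhds hmem), hw₀] with y hy hw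
    exact (fiberCoord_eq_div _ hy hw _).symm

end fiberCoord

/-! ### Sections of line bundles -/

namespace RealLineBundle

variable {G : RealGroupoid.{u}}

/-- A nowhere vanishing, possibly discontinuous, section of `L` with section data `p`. -/
structure Section (L : RealLineBundle G) (p : SectionData G RealAbGroup.circle) where
  sec : ∀ x, L.E x
  sec_ne_zero : ∀ x, sec x ≠ 0
  act_sec : ∀ (g : G.Arr) {x y : G.Obj} (gx : G.s g = x) (gy : G.r g = y),
    L.act g gx gy (sec x) = circleVal (p.arrow g) • sec y
  ν_sec : ∀ {x y : G.Obj} (h : G.ρ₀ x = y), L.ν h (sec x) = circleVal (p.real x) • sec y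
  continuousAt_germ : ∀ x,
    ContinuousAt (fun y => (⟨y, circleVal (p.germ x y) • sec y⟩ : TotalSpace ℂ L.E)) x

namespace Section

variable {L M : RealLineBundle G} {p q : SectionData G RealAbGroup.circle}

theorem continuousAt_smul_sec_iff (σ : L.Section p) {Y : Type*} [TopologicalSpace Y]
    {f : Y → G.Obj} {u : Y → ℂ} {y₀ : Y} :
    ContinuousAt (fun y => (⟨f y, u y • σ.sec (f y)⟩ : TotalSpace ℂ L.E)) y₀ ↔
      ContinuousAt f y₀ ∧
        ContinuousAt (fun y => u y * circleVal (-p.germ (f y₀) (f y))) y₀ := by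
  have hgerm : ContinuousAt f y₀ → ContinuousAt (fun y =>
      (⟨f y, circleVal (p.germ (f y₀) (f y)) • σ.sec (f y)⟩ : TotalSpace ℂ L.E)) y₀ :=
    fun hf => (σ.continuousAt_germ (f y₀)).comp hf
  refine ⟨fun h => ?_, fun ⟨hf, hu⟩ => ?_⟩
  · have hf := ((FiberBundle.continuousAt_totalSpace ℂ _).1 h).1
    have hne : ∀ y, circleVal (p.germ (f y₀) (f y)) • σ.sec (f y) ≠ 0 := fun y =>
      smul_ne_zero (circleVal_ne_zero _) (σ.sec_ne_zero _)
    refine ⟨hf, (continuousAt_fiberCoord (.of_forall hne) (hgerm hf) h).congr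
      (.of_forall fun y => ?_)⟩
    refine (congrArg _ ?_).trans (fiberCoord_apply_smul (hne y) _)
    beta_reduce
    rw [smul_smul, circleVal_neg, inv_mul_cancel_right₀ (circleVal_ne_zero _)]
  · refine (continuousAt_smul_mk hu (hgerm hf)).congr (.of_forall fun y => ?_)
    refine congrArg (TotalSpace.mk _) ?_
    rw [smul_smul, circleVal_neg, inv_mul_cancel_right₀ (circleVal_ne_zero _)]

theorem mk_eq_mk (σ : L.Section p) (τ : L.Section q) :
    (p : SectionClass G RealAbGroup.circle) = q := by
  choose F hF using fun x => exists_eq_smul (τ.sec_ne_zero x) (σ.sec x)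
  have hF₀ : ∀ x, F x ≠ 0 := fun x h => σ.sec_ne_zero x (by rw [hF, h, zero_smul])
  refine SectionClass.mk_eq_mk_iff.2
    ⟨fun x => phase (F x), fun g => ?_, fun x => ?_, fun x => ?_⟩
  · have h := σ.act_sec g rfl rfl
    rw [hF, hF (G.r g), map_smul, τ.act_sec g rfl rfl, smul_smul, smul_smul] at h
    have h := congrArg phase (smul_left_injective ℂ (τ.sec_ne_zero _) h)
    rw [phase_mul (hF₀ _) (circleVal_ne_zero _), phase_mul (circleVal_ne_zero _) (hF₀ _),
      phase_circleVal, phase_circleVal] at h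
    exact h.symm
  · have h := σ.ν_sec (x := x) rfl
    rw [hF, hF (G.ρ₀ x), LinearMap.map_smulₛₗ, τ.ν_sec rfl, smul_smul, smul_smul] at h
    have h := congrArg phase (smul_left_injective ℂ (τ.sec_ne_zero _) h)
    rw [phase_mul (by simpa using hF₀ x) (circleVal_ne_zero _), phase_conj (hF₀ x),
      phase_mul (circleVal_ne_zero _) (hF₀ _), phase_circleVal, phase_circleVal] at h
    exact h.symm
  · have hσ := σ.continuousAt_germ x
    simp only [hF, smul_smul] at hσ
    have hne : ∀ y, circleVal (p.germ x y) * F y * circleVal (-q.germ x y) ≠ 0 := fun y =>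
      mul_ne_zero (mul_ne_zero (circleVal_ne_zero _) (hF₀ y)) (circleVal_ne_zero _)
    refine ((continuousAt_phase (hne x)).comp_of_eq
      (τ.continuousAt_smul_sec_iff.1 hσ).2 rfl).congr (.of_forall fun y => ?_)
    rw [Function.comp_apply,
      phase_mul (mul_ne_zero (circleVal_ne_zero _) (hF₀ y)) (circleVal_ne_zero _),
      phase_mul (circleVal_ne_zero _) (hF₀ y), phase_circleVal, phase_circleVal,
      ← sub_eq_add_neg]

theorem nonempty_of_mk_eq_mk (τ : L.Section q)
    (h : (p : SectionClass G RealAbGroup.circle) = q) : Nonempty (L.Section p) := by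
  obtain ⟨f, harrow, hreal, hgerm⟩ := SectionClass.mk_eq_mk_iff.1 h
  refine ⟨⟨fun x => circleVal (f x) • τ.sec x,
    fun x => smul_ne_zero (circleVal_ne_zero _) (τ.sec_ne_zero x), ?_, ?_, fun x => ?_⟩⟩
  · rintro g _ _ rfl rfl
    rw [map_smul, τ.act_sec g rfl rfl, smul_smul, smul_smul, ← circleVal_add, ← circleVal_add,
      harrow]
  · rintro x _ rfl
    rw [LinearMap.map_smulₛₗ, τ.ν_sec rfl, ← circleVal_conj, smul_smul, smul_smul,
      ← circleVal_add, ← circleVal_add, hreal]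
  · simp only [smul_smul]
    refine τ.continuousAt_smul_sec_iff.2 ⟨continuousAt_id, ?_⟩
    refine (continuous_circleVal.continuousAt.comp (hgerm x)).congr (.of_forall fun y => ?_)
    rw [Function.comp_apply, sub_eq_add_neg, circleVal_add, circleVal_add]

/-- The image of a section under a homomorphism without kernel. -/
def map (φ : Hom L M) (hφ : ∀ x v, v ≠ 0 → φ.f x v ≠ 0) (σ : L.Section p) : M.Section p where
  sec x := φ.f x (σ.sec x)
  sec_ne_zero x := hφ x _ (σ.sec_ne_zero x)
  act_sec g _ _ gx gy := by rw [← φ.f_act, σ.act_sec, map_smul]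
  ν_sec h := by rw [← φ.f_ν, σ.ν_sec, map_smul]
  continuousAt_germ x := by
    simp only [← map_smul]
    exact φ.continuous_f.continuousAt.comp (σ.continuousAt_germ x)

theorem continuousAt_fiberCoord (σ : L.Section p) {Y : Type*} [TopologicalSpace Y]
    {F : Y → TotalSpace ℂ L.E} (hF : Continuous F) (y₀ : Y) :
    ContinuousAt (fun y => fiberCoord (σ.sec (F y).proj) (F y).2 *
      circleVal (-p.germ (F y₀).proj (F y).proj)) y₀ := by
  refine (σ.continuousAt_smul_sec_iff (f := fun y => (F y).proj)
    (u := fun y => fiberCoord (σ.sec (F y).proj) (F y).2)).1 ?_ |>.2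
  simp only [fiberCoord_smul_self (σ.sec_ne_zero _)]
  exact hF.continuousAt

theorem fiberCoord_act (σ : L.Section p) (g : G.Arr) {x y : G.Obj} (gx : G.s g = x)
    (gy : G.r g = y) (v : L.E x) :
    fiberCoord (σ.sec y) (L.act g gx gy v) =
      circleVal (p.arrow g) * fiberCoord (σ.sec x) v := by
  obtain ⟨z, rfl⟩ := exists_eq_smul (σ.sec_ne_zero x) v
  rw [map_smul, σ.act_sec, smul_smul, fiberCoord_apply_smul (σ.sec_ne_zero _),
    fiberCoord_apply_smul (σ.sec_ne_zero _), mul_comm]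

theorem fiberCoord_ν (σ : L.Section p) {x y : G.Obj} (h : G.ρ₀ x = y) (v : L.E x) :
    fiberCoord (σ.sec y) (L.ν h v) =
      circleVal (p.real x) * starRingEnd ℂ (fiberCoord (σ.sec x) v) := by
  obtain ⟨z, rfl⟩ := exists_eq_smul (σ.sec_ne_zero x) v
  rw [LinearMap.map_smulₛₗ, σ.ν_sec, smul_smul, fiberCoord_apply_smul (σ.sec_ne_zero _),
    fiberCoord_apply_smul (σ.sec_ne_zero _), mul_comm]

/-- The homomorphism that takes `σ` to `τ`. -/
def hom (σ : L.Section p) (τ : M.Section p) : Hom L M where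
  f x := (fiberCoord (σ.sec x)).smulRight (τ.sec x)
  continuous_f := continuous_iff_continuousAt.2 fun _ => τ.continuousAt_smul_sec_iff.2
    ⟨(FiberBundle.continuous_proj ℂ L.E).continuousAt, σ.continuousAt_fiberCoord continuous_id _⟩
  f_ν h v := by
    simp only [LinearMap.smulRight_apply, LinearMap.map_smulₛₗ, σ.fiberCoord_ν, τ.ν_sec, smul_smul,
      mul_comm]
  f_act g _ _ gx gy v := by
    simp only [LinearMap.smulRight_apply, map_smul, σ.fiberCoord_act, τ.act_sec, smul_smul,
      mul_comm]

theorem hom_hom (σ : L.Section p) (τ : M.Section p) (x : G.Obj) (v : L.E x) :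
    (τ.hom σ).f x ((σ.hom τ).f x v) = v :=
  (congrArg (· • _) (fiberCoord_apply_smul (τ.sec_ne_zero x) _)).trans
    (fiberCoord_smul_self (σ.sec_ne_zero x) v)

theorem isomorphic_iff (σ : L.Section p) (τ : M.Section q) :
    L.Isomorphic M ↔ (p : SectionClass G RealAbGroup.circle) = q := by
  constructor
  · rintro ⟨φ, ψ, hψφ, -⟩
    refine (σ.map φ fun x v hv h => hv ?_).mk_eq_mk τ
    rw [← hψφ x v, h, map_zero]
  · intro h
    obtain ⟨τ'⟩ := τ.nonempty_of_mk_eq_mk h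
    exact ⟨σ.hom τ', τ'.hom σ, σ.hom_hom τ', τ'.hom_hom σ⟩

end Section

end RealLineBundle

/-! ### Tensor products -/

theorem isTensorProduct_of_apply_ne_zero {V V' W : Type*} [AddCommGroup V] [Module ℂ V]
    [AddCommGroup V'] [Module ℂ V'] [AddCommGroup W] [Module ℂ W]
    (hV : Module.finrank ℂ V = 1) (hV' : Module.finrank ℂ V' = 1)
    (hW : Module.finrank ℂ W = 1) (β : V →ₗ[ℂ] V' →ₗ[ℂ] W) {v : V} {w : V'}
    (h : β v w ≠ 0) : IsTensorProduct β := by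
  have := Module.finite_of_finrank_eq_succ hV
  have := Module.finite_of_finrank_eq_succ hV'
  have := Module.finite_of_finrank_eq_succ hW
  have hsurj : Function.Surjective (TensorProduct.lift β) := fun u => by
    obtain ⟨z, rfl⟩ := exists_smul_eq_of_finrank_eq_one hW h u
    exact ⟨z • (v ⊗ₜ[ℂ] w), by rw [map_smul, TensorProduct.lift.tmul]⟩
  refine ⟨(LinearMap.injective_iff_surjective_of_finrank_eq_finrank ?_).2 hsurj, hsurj⟩
  rw [Module.finrank_tensorProduct, hV, hV', hW]

theorem apply_ne_zero_of_isTensorProduct {V V' W : Type*} [AddCommGroup V] [Module ℂ V]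
    [AddCommGroup V'] [Module ℂ V'] [AddCommGroup W] [Module ℂ W] [Nontrivial W]
    {β : V →ₗ[ℂ] V' →ₗ[ℂ] W} (hβ : IsTensorProduct β) {v : V} {v' : V'}
    (hv : ∀ a : V, ∃ z : ℂ, a = z • v) (hv' : ∀ a : V', ∃ z : ℂ, a = z • v') : β v v' ≠ 0 := by
  intro h
  obtain ⟨w, hw⟩ := exists_ne (0 : W)
  obtain ⟨t, rfl⟩ := hβ.2 w
  suffices TensorProduct.lift β = 0 from hw (by rw [this, LinearMap.zero_apply])
  refine TensorProduct.ext' fun a a' => ?_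
  obtain ⟨⟨z, rfl⟩, ⟨z', rfl⟩⟩ := And.intro (hv a) (hv' a')
  rw [TensorProduct.lift.tmul, map_smul, map_smul, LinearMap.smul_apply, h, smul_zero, smul_zero,
    LinearMap.zero_apply]

namespace RealLineBundle.Section

variable {G : RealGroupoid.{u}} {L L' M : HermitianRealLineBundle G}
  {p p' q : SectionData G RealAbGroup.circle}

theorem nonempty_add_of_isTensor (σ : L.Section p) (σ' : L'.Section p') (h : L.IsTensor L' M) :
    Nonempty (M.Section (p + p')) := by
  obtain ⟨β, hβ, hcont, hν, hact⟩ := h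
  refine ⟨⟨fun x => β x (σ.sec x) (σ'.sec x), fun x => ?_, fun g x y gx gy => ?_, fun {x y} h => ?_,
    fun x => ?_⟩⟩
  · have : Nontrivial (M.E x) :=
      (VectorBundle.continuousLinearEquivAt ℂ ℂ M.E x).toEquiv.nontrivial
    exact apply_ne_zero_of_isTensorProduct (hβ x) (exists_eq_smul (σ.sec_ne_zero x))
      (exists_eq_smul (σ'.sec_ne_zero x))
  · rw [← hact, σ.act_sec, σ'.act_sec, map_smul, map_smul, LinearMap.smul_apply, smul_smul,
      mul_comm, ← circleVal_add, SectionData.arrow_add]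
  · rw [← hν, σ.ν_sec, σ'.ν_sec, map_smul, map_smul, LinearMap.smul_apply, smul_smul,
      mul_comm, ← circleVal_add, SectionData.real_add]
  · have hpair : ContinuousAt (fun y => (⟨y, circleVal (p.germ x y) • σ.sec y,
        circleVal (p'.germ x y) • σ'.sec y⟩ : TotalSpace (ℂ × ℂ) (L.E ×ᵇ L'.E))) x :=
      (FiberBundle.Prod.isInducing_diag ℂ L.E ℂ L'.E).continuousAt_iff.2
        ((σ.continuousAt_germ x).prodMk (σ'.continuousAt_germ x))
    refine (hcont.continuousAt.comp hpair).congr (.of_forall fun y => ?_)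
    refine congrArg (TotalSpace.mk y) ?_
    change β y (circleVal _ • _) (circleVal _ • _) = _
    rw [map_smul, map_smul, LinearMap.smul_apply, smul_smul, mul_comm, ← circleVal_add,
      SectionData.germ_add]

theorem isTensor (σ : L.Section p) (σ' : L'.Section p') (τ : M.Section (p + p')) :
    L.IsTensor L' M := by
  refine ⟨fun x => (fiberCoord (σ.sec x)).smulRight
    ((fiberCoord (σ'.sec x)).smulRight (τ.sec x)), fun x => ?_, ?_, fun x y h v w => ?_,
    fun g x y gx gy v w => ?_⟩
  · refine isTensorProduct_of_apply_ne_zero (finrank_fiber L.E x) (finrank_fiber L'.E x)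
      (finrank_fiber M.E x) _ (v := σ.sec x) (w := σ'.sec x) ?_
    simp only [LinearMap.smulRight_apply, LinearMap.smul_apply]
    rw [fiberCoord_self (σ.sec_ne_zero x), fiberCoord_self (σ'.sec_ne_zero x), one_smul, one_smul]
    exact τ.sec_ne_zero x
  · refine continuous_iff_continuousAt.2 fun a => ?_
    have hdiag := (FiberBundle.Prod.isInducing_diag ℂ L.E ℂ L'.E).continuous
    have hproj := (FiberBundle.continuous_proj ℂ L.E).comp hdiag.fst
    simp only [LinearMap.smulRight_apply, LinearMap.smul_apply, smul_smul]
    refine τ.continuousAt_smul_sec_iff.2 ⟨hproj.continuousAt, ?_⟩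
    refine ((σ.continuousAt_fiberCoord hdiag.fst a).mul
      (σ'.continuousAt_fiberCoord hdiag.snd a)).congr (.of_forall fun b => ?_)
    beta_reduce
    rw [SectionData.germ_add, neg_add, circleVal_add, mul_mul_mul_comm]
    rfl
  · simp only [LinearMap.smulRight_apply, LinearMap.smul_apply, LinearMap.map_smulₛₗ,
      σ.fiberCoord_ν, σ'.fiberCoord_ν, τ.ν_sec, smul_smul,
      map_mul, SectionData.real_add, circleVal_add]
    ring_nf
  · simp only [LinearMap.smulRight_apply, LinearMap.smul_apply, map_smul, σ.fiberCoord_act,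
      σ'.fiberCoord_act, τ.act_sec, smul_smul, SectionData.arrow_add, circleVal_add]
    ring_nf

theorem isTensor_iff (σ : L.Section p) (σ' : L'.Section p') (τ : M.Section q) :
    L.IsTensor L' M ↔ (p : SectionClass G RealAbGroup.circle) + p' = q := by
  constructor
  · intro h
    obtain ⟨τ'⟩ := nonempty_add_of_isTensor σ σ' h
    exact τ'.mk_eq_mk τ
  · intro h
    obtain ⟨τ'⟩ := τ.nonempty_of_mk_eq_mk (p := p + p') h
    exact isTensor σ σ' τ'

end RealLineBundle.Section

/-! ### Unit frames -/

namespace HermitianRealLineBundle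

variable {G : RealGroupoid.{u}} {L : HermitianRealLineBundle G}

theorem ne_zero_of_h_eq_one {x : G.Obj} {v : L.E x} (hv : L.h ⟨x, v⟩ = 1) : v ≠ 0 := by
  rintro rfl
  have h := L.h_smul x 0 0
  rw [zero_smul, hv, norm_zero, zero_pow two_ne_zero, mul_zero] at h
  exact one_ne_zero h

theorem norm_fiberCoord {x : G.Obj} {v w : L.E x} (hv : L.h ⟨x, v⟩ = 1) (hw : L.h ⟨x, w⟩ = 1) :
    ‖fiberCoord w v‖ = 1 := by
  rw [← fiberCoord_smul_self (ne_zero_of_h_eq_one hw) v, L.h_smul, hw, one_mul] at hv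
  exact (pow_eq_one_iff_of_nonneg (norm_nonneg _) two_ne_zero).1 hv

/-- The unit vector in the direction of a nonzero vector. -/
def normalize {x : G.Obj} (v : L.E x) : L.E x := ((√(L.h ⟨x, v⟩))⁻¹ : ℂ) • v

theorem h_normalize {x : G.Obj} {v : L.E x} (hv : v ≠ 0) : L.h ⟨x, normalize v⟩ = 1 := by
  have h := L.h_pos x v hv
  rw [normalize, L.h_smul, norm_inv, Complex.norm_real, Real.norm_eq_abs, inv_pow, sq_abs,
    Real.sq_sqrt h.le, mul_inv_cancel₀ h.ne']

theorem ν_normalize {x y : G.Obj} (h : G.ρ₀ x = y) (v : L.E x) :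
    L.ν h (normalize v) = normalize (L.ν h v) := by
  rw [normalize, normalize, LinearMap.map_smulₛₗ, L.h_ν, map_inv₀, Complex.conj_ofReal]

theorem continuousAt_normalize {v : ∀ x, L.E x} {x : G.Obj} (hx : v x ≠ 0)
    (hv : ContinuousAt (fun y => (⟨y, v y⟩ : TotalSpace ℂ L.E)) x) :
    ContinuousAt (fun y => (⟨y, normalize (v y)⟩ : TotalSpace ℂ L.E)) x := by
  have h : ContinuousAt (fun y => (√(L.h ⟨y, v y⟩) : ℂ)) x :=
    (Complex.continuous_ofReal.comp (Real.continuous_sqrt.comp L.continuous_h)).continuousAt.comp hv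
  exact continuousAt_smul_mk (f := id) (h.inv₀ (Complex.ofReal_ne_zero.2
    (Real.sqrt_ne_zero'.2 (L.h_pos x _ hx)))) hv

variable (L) in
/-- A Real cover of the unit space with Real unit frames over its members. -/
structure UnitFrames extends UnitCover G where
  e : J → ∀ x, L.E x
  h_e : ∀ {j x}, x ∈ U j → L.h ⟨x, e j x⟩ = 1
  continuousAt_e : ∀ {j x}, x ∈ U j →
    ContinuousAt (fun y => (⟨y, e j y⟩ : TotalSpace ℂ L.E)) x
  ν_e : ∀ {j x y} (h : G.ρ₀ x = y), x ∈ U j → L.ν h (e j x) = e (bar j) y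

variable (L) in
theorem nonempty_unitFrames : Nonempty L.UnitFrames := by
  obtain ⟨J, bar, U, t, bar_bar, isOpen_U, U_bar, exists_mem, ht, tν⟩ := L.locallyTrivial
  have hlin : ∀ j, (t j).IsLinear ℂ := fun j => (ht j).2
  have hbase : ∀ {j x}, x ∈ U j → x ∈ (t j).baseSet := fun hx => (ht _).1.symm ▸ hx
  have htsymm : ∀ {j x}, x ∈ U j → t j ⟨x, (t j).symm x 1⟩ = (x, 1) := fun hx =>
    (t _).apply_mk_symm (hbase hx) 1
  have hne : ∀ {j x}, x ∈ U j → (t j).symm x 1 ≠ 0 := fun {j x} hx h => by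
    refine zero_ne_one (α := ℂ) (((t j).linear ℂ (hbase hx)).map_zero.symm.trans ?_)
    rw [← h, htsymm hx]
  have hcont : ∀ {j x}, x ∈ U j →
      ContinuousAt (fun y => (⟨y, (t j).symm y 1⟩ : TotalSpace ℂ L.E)) x := fun {j x} hx =>
    ((t j).continuousOn_symm.comp (f := fun y => (y, (1 : ℂ))) (by fun_prop)
      fun y hy => ⟨hbase hy, trivial⟩).continuousAt ((isOpen_U j).mem_nhds hx)
  refine ⟨⟨⟨J, bar, bar_bar, U, isOpen_U, U_bar, exists_mem⟩,
    fun j x => normalize ((t j).symm x 1), fun hx => h_normalize (hne hx),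
    fun hx => continuousAt_normalize (hne hx) (hcont hx), fun {j x y} h hx => ?_⟩⟩
  have hy : y ∈ U (bar j) := by rw [U_bar]; exact ⟨x, hx, h⟩
  rw [ν_normalize]
  refine congrArg normalize (((t (bar j)).linearEquivAt ℂ y (hbase hy)).injective ?_)
  change (t (bar j) _).2 = (t (bar j) _).2
  rw [tν j x y h _ hx, htsymm hx, htsymm hy, map_one]

namespace UnitFrames

variable (e : L.UnitFrames)

/-- The multipliers of a groupoid action in unit frames. -/
def multiplier (a b : e.J) (g : G.Arr) : RealAbGroup.circle.S :=
  phase (fiberCoord (e.e a (G.r g)) (L.act g rfl rfl (e.e b (G.s g))))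

variable {e} {a b : e.J}

theorem ne_zero {x : G.Obj} (hx : x ∈ e.U a) : e.e a x ≠ 0 := ne_zero_of_h_eq_one (e.h_e hx)

theorem circleVal_multiplier {g : G.Arr} (ha : G.r g ∈ e.U a) (hb : G.s g ∈ e.U b) :
    circleVal (e.multiplier a b g) =
      fiberCoord (e.e a (G.r g)) (L.act g rfl rfl (e.e b (G.s g))) :=
  circleVal_phase_of_norm_eq_one
    (norm_fiberCoord ((L.h_act g rfl rfl _).trans (e.h_e hb)) (e.h_e ha))

theorem act_e {g : G.Arr} {x y : G.Obj} (gx : G.s g = x) (gy : G.r g = y) (ha : y ∈ e.U a)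
    (hb : x ∈ e.U b) :
    L.act g gx gy (e.e b x) = circleVal (e.multiplier a b g) • e.e a y := by
  subst gx gy
  rw [circleVal_multiplier ha hb, fiberCoord_smul_self (ne_zero ha)]

theorem smul_e_inj {x : G.Obj} (ha : x ∈ e.U a) {c c' : RealAbGroup.circle.S} :
    circleVal c • e.e a x = circleVal c' • e.e a x ↔ c = c' :=
  ((smul_left_injective ℂ (ne_zero ha)).comp circleVal_injective).eq_iff

theorem continuousAt_multiplier {g : G.Arr} (ha : G.r g ∈ e.U a) (hb : G.s g ∈ e.U b) :
    ContinuousAt (e.multiplier a b) g := by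
  have hs : ContinuousAt (fun g => (⟨G.s g, e.e b (G.s g)⟩ : TotalSpace ℂ L.E)) g :=
    (e.continuousAt_e hb).comp G.continuous_s.continuousAt
  have hr : ContinuousAt (fun g => (⟨G.r g, e.e a (G.r g)⟩ : TotalSpace ℂ L.E)) g :=
    (e.continuousAt_e ha).comp G.continuous_r.continuousAt
  have hact : ContinuousAt (fun g => (⟨G.r g, L.act g rfl rfl (e.e b (G.s g))⟩ :
      TotalSpace ℂ L.E)) g :=
    L.continuous_act.continuousAt.comp (f := fun g => ⟨(g, ⟨G.s g, e.e b (G.s g)⟩), rfl⟩)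
      (IsInducing.subtypeVal.continuousAt_iff.2 (continuousAt_id.prodMk hs))
  have hne : ∀ᶠ g in 𝓝 g, e.e a (G.r g) ≠ 0 :=
    (G.continuous_r.continuousAt.eventually (e.eventually_mem ha)).mono fun _ => ne_zero
  refine (continuousAt_phase ?_).comp (continuousAt_fiberCoord (f := G.r) hne hr hact)
  rw [← circleVal_multiplier ha hb]
  exact circleVal_ne_zero _

variable (e)

/-- The transition data of unit frames. -/
def transitionData : TransitionData G RealAbGroup.circle where
  toUnitCover := e.toUnitCover
  c := e.multiplier
  c_mul a b d g h k ha hb hd := by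
    have hgh := L.act_mul g h rfl k.symm rfl rfl (e.e d (G.s h))
    rw [act_e _ _ hb hd, map_smul, act_e _ _ ha hb, act_e _ _ ha hd, smul_smul,
      ← circleVal_add, smul_e_inj ha] at hgh
    rw [hgh, add_comm]
  c_ρ a b g ha hb := by
    have hg := L.act_ν g rfl rfl rfl rfl (e.e b (G.s g))
    rwa [act_e _ _ ha hb, LinearMap.map_smulₛₗ, e.ν_e _ hb, e.ν_e _ ha,
      act_e _ _ (e.ρ_mem ha) (e.ρ_mem hb), ← circleVal_conj, smul_e_inj (e.ρ_mem ha)] at hg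
  continuousOn_c _ _ _ hg := (continuousAt_multiplier hg.1 hg.2).continuousWithinAt

variable {e} in
theorem change_smul_e {x : G.Obj} (ha : x ∈ e.U a) (hb : x ∈ e.U b) :
    circleVal (e.transitionData.change a b x) • e.e a x = e.e b x :=
  (act_e (G.s_one x) (G.r_one x) ha hb).symm.trans (L.act_one x _)

/-- The section that selects a frame at every point. -/
def toSection : L.Section e.transitionData.sectionData where
  sec x := e.e (e.idx x) x
  sec_ne_zero x := ne_zero (e.mem_idx x)
  act_sec g x y gx gy := by
    subst gx gy
    exact act_e rfl rfl (e.mem_idx _) (e.mem_idx _)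
  ν_sec {x y} h := by
    subst h
    rw [e.ν_e rfl (e.mem_idx x)]
    exact (change_smul_e (e.mem_idx _) (e.ρ_mem (e.mem_idx x))).symm
  continuousAt_germ x := by
    refine (e.continuousAt_e (e.mem_idx x)).congr ?_
    filter_upwards [e.eventually_mem (e.mem_idx x)] with y hy
    exact congrArg (TotalSpace.mk y) (change_smul_e (e.mem_idx y) hy).symm

end UnitFrames

end HermitianRealLineBundle

/-! ### The line bundle of transition data -/

namespace TransitionData

variable {G : RealGroupoid.{u}} (D : TransitionData G RealAbGroup.circle)

/-- The underlying vector bundle of the bundle with given transition data. -/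
def core : VectorBundleCore ℂ G.Obj ℂ D.J where
  baseSet := D.U
  isOpen_baseSet := D.isOpen_U
  indexAt := D.idx
  mem_baseSet_at := D.mem_idx
  coordChange i j x := circleVal (D.change j i x) • ContinuousLinearMap.id ℂ ℂ
  coordChange_self i x hx v := by
    rw [change_self hx, circleVal_zero, one_smul, ContinuousLinearMap.id_apply]
  continuousOn_coordChange i j x hx := (ContinuousAt.smul
    (continuous_circleVal.continuousAt.comp (continuousAt_change hx.2 hx.1))
    continuousAt_const).continuousWithinAt
  coordChange_comp i j k x hx v := by
    simp only [_root_.smul_apply, ContinuousLinearMap.id_apply, smul_smul]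
    rw [← circleVal_add, change_add_change hx.2 hx.1.2 hx.1.1]

/-- The coordinate of a vector in the frame with index `a`. -/
def coord (a : D.J) {x : G.Obj} : D.core.Fiber x →ₗ[ℂ] ℂ :=
  circleVal (D.change a (D.idx x) x) • LinearMap.id (R := ℂ) (M := ℂ)

/-- The vector with a given coordinate in the frame with index `a`. -/
def ofCoord (a : D.J) (x : G.Obj) : ℂ →ₗ[ℂ] D.core.Fiber x :=
  circleVal (D.change (D.idx x) a x) • LinearMap.id (R := ℂ) (M := ℂ)

variable {D} {a b : D.J} {x y : G.Obj}

theorem coord_apply (v : D.core.Fiber x) :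
    D.coord a v = circleVal (D.change a (D.idx x) x) * (show ℂ from v) := rfl

theorem coord_injective : Function.Injective (D.coord a (x := x)) :=
  mul_right_injective₀ (M₀ := ℂ) (circleVal_ne_zero _)

theorem coord_ofCoord (ha : x ∈ D.U a) (hb : x ∈ D.U b) (z : ℂ) :
    D.coord a (D.ofCoord b x z) = circleVal (D.change a b x) * z := by
  rw [← change_add_change ha (D.mem_idx x) hb, circleVal_add, mul_assoc]
  rfl

theorem coord_ofCoord_self (ha : x ∈ D.U a) (z : ℂ) : D.coord a (D.ofCoord a x z) = z := by
  rw [coord_ofCoord ha ha, change_self ha, circleVal_zero, one_mul]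

theorem circleVal_change_mul_coord (ha : x ∈ D.U a) (hb : x ∈ D.U b) (v : D.core.Fiber x) :
    circleVal (D.change a b x) * D.coord b v = D.coord a v := by
  rw [coord_apply, coord_apply, ← mul_assoc, ← circleVal_add,
    change_add_change ha hb (D.mem_idx x)]

theorem norm_coord (ha : x ∈ D.U a) (hb : x ∈ D.U b) (v : D.core.Fiber x) :
    ‖D.coord a v‖ = ‖D.coord b v‖ := by
  rw [← circleVal_change_mul_coord ha hb, norm_mul, norm_circleVal, one_mul]

theorem continuousAt_totalSpace_iff {Y : Type*} [TopologicalSpace Y]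
    {F : Y → TotalSpace ℂ D.core.Fiber} {y₀ : Y} (ha : (F y₀).proj ∈ D.U a) :
    ContinuousAt F y₀ ↔
      ContinuousAt (fun y => (F y).proj) y₀ ∧ ContinuousAt (fun y => D.coord a (F y).2) y₀ :=
  (D.core.localTriv a).tendsto_nhds_iff ((D.core.localTriv a).mem_source.2 ha)

theorem continuousAt_coord {v : TotalSpace ℂ D.core.Fiber} (ha : v.proj ∈ D.U a) :
    ContinuousAt (fun v : TotalSpace ℂ D.core.Fiber => D.coord a v.2) v :=
  ((continuousAt_totalSpace_iff ha).1 continuousAt_id).2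

variable (D) in
theorem continuous_proj : Continuous fun v : TotalSpace ℂ D.core.Fiber => v.proj :=
  FiberBundle.continuous_proj ℂ D.core.Fiber

variable (D) in
/-- The action of an arrow `g` from `x` to `y`. -/
def act (g : G.Arr) (x y : G.Obj) : D.core.Fiber x →ₗ[ℂ] D.core.Fiber y :=
  circleVal (D.c (D.idx y) (D.idx x) g) • LinearMap.id (R := ℂ) (M := ℂ)

variable (D) in
/-- The Real structure on the fibre over `x`, where `y` is the conjugate of `x`. -/
def real (x y : G.Obj) : D.core.Fiber x →ₛₗ[starRingEnd ℂ] D.core.Fiber y :=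
  (D.ofCoord (D.bar (D.idx x)) y).comp (starLinearEquiv ℂ (A := ℂ)).toLinearMap

theorem coord_act {g : G.Arr} (gx : G.s g = x) (gy : G.r g = y) (ha : y ∈ D.U a)
    (hb : x ∈ D.U b) (v : D.core.Fiber x) :
    D.coord a (D.act g x y v) = circleVal (D.c a b g) * D.coord b v := by
  subst gx gy
  change _ * (_ * (show ℂ from v)) = _
  rw [coord_apply, ← mul_assoc, ← mul_assoc, ← circleVal_add, ← circleVal_add,
    change_add_c ha (D.mem_idx _) (D.mem_idx _), c_add_change ha hb (D.mem_idx _)]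

theorem coord_real (h : G.ρ₀ x = y) (ha : x ∈ D.U a) (v : D.core.Fiber x) :
    D.coord (D.bar a) (D.real x y v) = starRingEnd ℂ (D.coord a v) := by
  subst h
  refine (coord_ofCoord (D.ρ_mem ha) (D.ρ_mem (D.mem_idx x)) _).trans ?_
  rw [change_ρ ha (D.mem_idx x), circleVal_conj, coord_apply, map_mul]
  rfl

variable (D)

theorem continuous_real : Continuous fun v : TotalSpace ℂ D.core.Fiber =>
    (⟨G.ρ₀ v.proj, D.real v.proj (G.ρ₀ v.proj) v.snd⟩ : TotalSpace ℂ D.core.Fiber) :=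
  continuous_iff_continuousAt.2 fun v =>
    (continuousAt_totalSpace_iff (D.ρ_mem (D.mem_idx v.proj))).2
      ⟨(G.continuous_ρ₀.comp D.continuous_proj).continuousAt,
        (Complex.continuous_conj.continuousAt.comp (continuousAt_coord (D.mem_idx v.proj))).congr <|
          (D.continuous_proj.continuousAt.eventually (D.eventually_mem (D.mem_idx v.proj))).mono
            fun w hw => (coord_real rfl hw w.2).symm⟩

theorem continuous_act : Continuous fun p : {p : G.Arr × TotalSpace ℂ D.core.Fiber //
    G.s p.1 = p.2.proj} => (⟨G.r p.1.1, D.act p.1.1 p.1.2.proj (G.r p.1.1) p.1.2.snd⟩ :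
      TotalSpace ℂ D.core.Fiber) := by
  refine continuous_iff_continuousAt.2 fun ⟨⟨g₀, v₀⟩, (h₀ : G.s g₀ = v₀.proj)⟩ => ?_
  have hg : Continuous fun p : {p : G.Arr × TotalSpace ℂ D.core.Fiber //
      G.s p.1 = p.2.proj} => p.1.1 := continuous_fst.comp continuous_subtype_val
  have hv : Continuous fun p : {p : G.Arr × TotalSpace ℂ D.core.Fiber //
      G.s p.1 = p.2.proj} => p.1.2 := continuous_snd.comp continuous_subtype_val
  have hb := D.mem_idx v₀.proj
  have hc := (D.continuousOn_c (D.idx (G.r g₀)) (D.idx v₀.proj)).continuousAt <|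
    (((D.isOpen_U _).preimage G.continuous_r).inter
      ((D.isOpen_U _).preimage G.continuous_s)).mem_nhds ⟨D.mem_idx _, h₀ ▸ hb⟩
  refine (continuousAt_totalSpace_iff (D.mem_idx (G.r g₀))).2
    ⟨(G.continuous_r.comp hg).continuousAt,
      ((continuous_circleVal.continuousAt.comp (hc.comp_of_eq hg.continuousAt rfl)).mul
        ((continuousAt_coord hb).comp_of_eq hv.continuousAt rfl)).congr ?_⟩
  filter_upwards [(G.continuous_r.comp hg).continuousAt.eventually
      (D.eventually_mem (D.mem_idx (G.r g₀))),
    (D.continuous_proj.comp hv).continuousAt.eventually (D.eventually_mem hb)] with p hr hs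
  exact (coord_act p.2 rfl hr hs _).symm

/-- The Real line bundle with given transition data. -/
def bundle : RealLineBundle G where
  E := D.core.Fiber
  ν {x y} _ := D.real x y
  ν_ν {x y} h h' v := by
    have hx := D.mem_idx x
    refine coord_injective (a := D.bar (D.bar (D.idx x))) ?_
    rw [coord_real h' (h ▸ D.ρ_mem hx), coord_real h hx, Complex.conj_conj, D.bar_bar]
  continuous_ν := D.continuous_real
  act g {x y} _ _ := D.act g x y
  act_one x v := by
    refine coord_injective (a := D.idx x) ?_
    rw [coord_act (G.s_one x) (G.r_one x) (D.mem_idx x) (D.mem_idx x)]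
    exact circleVal_change_mul_coord (D.mem_idx x) (D.mem_idx x) v
  act_mul g h {x y z} hx hy gy gz v := by
    refine coord_injective (a := D.idx z) ?_
    rw [coord_act _ _ (D.mem_idx z) (D.mem_idx x), coord_act gy gz (D.mem_idx z) (D.mem_idx y),
      coord_act hx hy (D.mem_idx y) (D.mem_idx x),
      D.c_mul _ (D.idx y) _ g h _ (gz ▸ D.mem_idx z) (gy ▸ D.mem_idx y) (hx ▸ D.mem_idx x),
      circleVal_add, mul_assoc]
    exacts [(G.s_mul g h _).trans hx, (G.r_mul g h _).trans gz]
  act_ν g {x y x' y'} gx gy hx hy v := by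
    have hmx := D.mem_idx x
    have hmy := D.mem_idx y
    refine coord_injective (a := D.bar (D.idx y)) ?_
    rw [coord_act _ _ (hy ▸ D.ρ_mem hmy) (hx ▸ D.ρ_mem hmx), coord_real hx hmx, coord_real hy hmy,
      coord_act gx gy hmy hmx, map_mul, ← circleVal_conj,
      D.c_ρ _ _ g (gy ▸ hmy) (gx ▸ hmx)]
    exacts [(G.s_ρ g).trans (gx ▸ hx), (G.r_ρ g).trans (gy ▸ hy)]
  continuous_act := D.continuous_act

/-- The hermitian Real line bundle with given transition data. -/
def hermitianBundle : HermitianRealLineBundle G where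
  toRealLineBundle := D.bundle
  locallyTrivial := ⟨D.J, D.bar, D.U, D.core.localTriv, D.bar_bar, D.isOpen_U, D.U_bar,
    D.exists_mem, fun j => ⟨rfl, VectorBundleCore.localTriv.isLinear D.core j⟩,
    fun _ _ _ h v hx => coord_real h hx v⟩
  h v := ‖D.coord (D.idx v.proj) v.2‖ ^ 2
  continuous_h := continuous_iff_continuousAt.2 fun v => by
    refine ((continuousAt_coord (D.mem_idx v.proj)).norm.pow 2).congr ?_
    filter_upwards [D.continuous_proj.continuousAt.eventually
      (D.eventually_mem (D.mem_idx v.proj))] with w hw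
    exact congrArg (· ^ 2) (norm_coord hw (D.mem_idx _) w.2)
  h_ν {x y} h v := by
    have hx := D.mem_idx x
    refine congrArg (· ^ 2) ((norm_coord (D.mem_idx y) (h ▸ D.ρ_mem hx) _).trans ?_)
    exact (congrArg _ (coord_real h hx v)).trans (RCLike.norm_conj _)
  h_smul x z v := by
    refine (congrArg (‖·‖ ^ 2) ((D.coord (D.idx x)).map_smul z v)).trans ?_
    rw [smul_eq_mul, norm_mul, mul_pow, mul_comm]
  h_act g x y gx gy v := by
    refine congrArg (· ^ 2) ((congrArg _
      (coord_act gx gy (D.mem_idx y) (D.mem_idx x) v)).trans ?_)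
    rw [norm_mul, norm_circleVal, one_mul]
  h_pos x v hv := pow_pos (norm_pos_iff.2 ((map_ne_zero_iff _ coord_injective).2 hv)) 2

/-- The section that is `1` in the frame selected at every point. -/
def hermitianBundleSection : D.hermitianBundle.Section D.sectionData where
  sec _ := (1 : ℂ)
  sec_ne_zero _ := one_ne_zero (α := ℂ)
  act_sec g x y gx gy := by subst gx gy; rfl
  ν_sec {x y} h := by
    subst h
    exact congrArg (_ * ·) (map_one (starRingEnd ℂ))
  continuousAt_germ x := by
    refine (continuousAt_totalSpace_iff (D.mem_idx x)).2 ⟨continuousAt_id, ?_⟩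
    refine (continuousAt_const (y := (1 : ℂ))).congr ?_
    filter_upwards [D.eventually_mem (D.mem_idx x)] with y hy
    exact (coord_ofCoord_self hy 1).symm

end TransitionData

/-! ### The Real Picard group -/

theorem CechHR.range_cls (S : RealAbGroup) (G : RealGroupoid.{u}) :
    Set.range (CechHR.cls S G) = Set.range (TransitionData.cls (G := G) (S := S)) :=
  Set.Subset.antisymm (Set.range_subset_iff.2 fun q => exists_cls_transitionData_eq q)
    (Set.range_subset_iff.2 fun D => D.exists_cechCls_eq)

variable {G : RealGroupoid.{u}}

namespace HermitianRealLineBundle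

/-- The class of the section data of any section, which characterizes the bundle up to
isomorphism. -/
def cls (L : HermitianRealLineBundle G) : SectionClass G RealAbGroup.circle :=
  L.nonempty_unitFrames.some.transitionData.cls

variable {L L' M : HermitianRealLineBundle G}

theorem isomorphic_iff_cls_eq :
    L.toRealLineBundle.Isomorphic M.toRealLineBundle ↔ L.cls = M.cls :=
  L.nonempty_unitFrames.some.toSection.isomorphic_iff M.nonempty_unitFrames.some.toSection

theorem isTensor_iff_cls_add_eq : L.IsTensor L' M ↔ L.cls + L'.cls = M.cls :=
  L.nonempty_unitFrames.some.toSection.isTensor_iff L'.nonempty_unitFrames.some.toSection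
    M.nonempty_unitFrames.some.toSection

end HermitianRealLineBundle

theorem TransitionData.cls_hermitianBundle (D : TransitionData G RealAbGroup.circle) :
    D.hermitianBundle.cls = D.cls :=
  D.hermitianBundle.nonempty_unitFrames.some.toSection.mk_eq_mk D.hermitianBundleSection

namespace PicR

/-- The section class of an isomorphism class of bundles. -/
def cls (p : PicR G) : SectionClass G RealAbGroup.circle :=
  Quotient.lift HermitianRealLineBundle.cls
    (fun _ _ h => HermitianRealLineBundle.isomorphic_iff_cls_eq.1 h) p

theorem cls_injective : Function.Injective (cls (G := G)) := by
  rintro ⟨L⟩ ⟨M⟩ h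
  exact Quotient.sound (HermitianRealLineBundle.isomorphic_iff_cls_eq.2 h)

variable (G) in
theorem range_cls :
    Set.range (cls (G := G)) = Set.range (TransitionData.cls (G := G)) := by
  refine Set.Subset.antisymm (Set.range_subset_iff.2 ?_) (Set.range_subset_iff.2 fun D => ?_)
  · rintro ⟨L⟩
    exact ⟨_, rfl⟩
  · exact ⟨mk D.hermitianBundle, D.cls_hermitianBundle⟩

variable (G) in
/-- The bijection between bundles and cohomology classes with the same section class. -/
def equivCechHR : PicR G ≃ Multiplicative (CechHR G.nerve RealAbGroup.circle 1) :=
  (Equiv.ofInjective cls cls_injective).trans <|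
    (Equiv.setCongr ((range_cls G).trans (CechHR.range_cls _ G).symm)).trans <|
      (Equiv.ofInjective _ CechHR.cls_injective).symm.trans Multiplicative.ofAdd

theorem cls_equivCechHR (p : PicR G) :
    CechHR.cls RealAbGroup.circle G (equivCechHR G p).toAdd = p.cls :=
  Equiv.apply_ofInjective_symm CechHR.cls_injective _

theorem equivCechHR_mul_eq_iff {L L' M : HermitianRealLineBundle G} :
    equivCechHR G (mk L) * equivCechHR G (mk L') = equivCechHR G (mk M) ↔ L.IsTensor L' M := by
  rw [HermitianRealLineBundle.isTensor_iff_cls_add_eq, ← Multiplicative.toAdd.injective.eq_iff,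
    toAdd_mul, ← CechHR.cls_injective.eq_iff, (CechHR.cls _ G).map_add, cls_equivCechHR,
    cls_equivCechHR, cls_equivCechHR]
  rfl

end PicR

end

theorem mainTheorem3_general (G : RealGroupoid.{u}) :
    ∃ _ : CommGroup (PicR G),
      (∀ L L' M : HermitianRealLineBundle G,
        PicR.mk L * PicR.mk L' = PicR.mk M ↔ L.IsTensor L' M) ∧
      Nonempty (PicR G ≃* Multiplicative (CechHR G.nerve RealAbGroup.circle 1)) := by
  let _ : CommGroup (PicR G) := (PicR.equivCechHR G).commGroup
  let e : PicR G ≃* Multiplicative (CechHR G.nerve RealAbGroup.circle 1) :=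
    (PicR.equivCechHR G).mulEquiv
  refine ⟨inferInstance, fun L L' M => ?_, ⟨e⟩⟩
  rw [← e.injective.eq_iff, map_mul]
  exact PicR.equivCechHR_mul_eq_iff

theorem mainTheorem3 (G : RealGroupoid.{u}) [T2Space G.Arr] [LocallyCompactSpace G.Arr] :
    ∃ _ : CommGroup (PicR G),
      (∀ L L' M : HermitianRealLineBundle G,
        PicR.mk L * PicR.mk L' = PicR.mk M ↔ L.IsTensor L' M) ∧
      Nonempty (PicR G ≃* Multiplicative (CechHR G.nerve RealAbGroup.circle 1)) :=
  mainTheorem3_general G
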